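/- **Language.** Fix a set of individual constants, a set of predicate symbols with arities, and for each $n\ge 1$ a set of $n$-ary relational constants (any of these may be empty). There are countably infinitely many individual variables $x,y,\dots$ and, disjoint from them, countably infinitely many individual parameters $a,b,c,\dots$; likewise, for each $n\ge1$, countably infinitely many $n$-ary relational variables $X,Y,\dots$ and $n$-ary relational parameters $A,B,C,\dots$. Terms are individual variables, parameters and constants. Atomic formulas are $t_1=t_2$, $P(t_1,\dots,t_n)$, $X=Y$ and $X(t_1,\dots,t_n)$, where the $t_i$ are terms, $P$ is an $n$-ary predicate symbol, and $X,Y$ are $n$-ary relational variables, parameters or constants. Formulas are built from these with $\neg,\wedge,\vee,\to,\leftrightarrow$, the quantifiers $\forall x,\exists x,\forall X,\exists X$, and the formation of $(\lambda x\,\psi)t$ ($t$ a term), $(\lambda x\,\psi)\iota y\,\varphi$, and $(\lambda X\,\psi)\iota Y\,\varphi$ ($X,Y$ of the same arity); $\lambda x,\lambda X$ bind in $\psi$, $\iota y,\iota Y$ bind in $\varphi$. $\varphi^x_b$ (resp. $\varphi^X_B$) is the result of replacing the free occurrences of $x$ (resp. $X$) in $\varphi$ by the parameter $b$ (resp. $B$,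 of the same arity). A sequent $\Gamma\Rightarrow\Delta$ is a pair of finite multisets of formulas. **The calculus $\mathbf{RLL}$.** Below, $b,c,b_1,\dots$ are arbitrary individual parameters and $B,C$ arbitrary relational parameters; $a$ (resp. $A$) is an eigenvariable: it does not occur in $\Gamma,\Delta,\varphi$, nor in $\psi$ in the rules $(\iota_1\Rightarrow)$, $(\iota_1^2\Rightarrow)$, and it is different from $b$ (resp. $B$) in $(\Rightarrow\iota)$, $(\Rightarrow\iota^2)$; $a_1,\dots,a_n$ are pairwise distinct and do not occur in $\Gamma,\Delta$. "Premises / conclusion": - (AX) $\varphi\Rightarrow\varphi$; weakening and contraction on both sides; (Cut) $\Gamma\Rightarrow\Delta,\varphi$ and $\varphi,\Pi\Rightarrow\Sigma$ / $\Gamma,\Pi\Rightarrow\Delta,\Sigma$. - $(\wedge\Rightarrow)$ $\varphi,\psi,\Gamma\Rightarrow\Delta$ / $\varphi\wedge\psi,\Gamma\Rightarrow\Delta$; $(\Rightarrow\wedge)$ $\Gamma\Rightarrow\Delta,\varphi$ and $\Gamma\Rightarrow\Delta,\psi$ / $\Gamma\Rightarrow\Delta,\varphi\wedge\psi$. - $(\vee\Rightarrow)$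 $\varphi,\Gamma\Rightarrow\Delta$ and $\psi,\Gamma\Rightarrow\Delta$ / $\varphi\vee\psi,\Gamma\Rightarrow\Delta$; $(\Rightarrow\vee)$ $\Gamma\Rightarrow\Delta,\varphi,\psi$ / $\Gamma\Rightarrow\Delta,\varphi\vee\psi$. - $(\neg\Rightarrow)$ $\Gamma\Rightarrow\Delta,\varphi$ / $\neg\varphi,\Gamma\Rightarrow\Delta$; $(\Rightarrow\neg)$ $\varphi,\Gamma\Rightarrow\Delta$ / $\Gamma\Rightarrow\Delta,\neg\varphi$. - $(\to\Rightarrow)$ $\Gamma\Rightarrow\Delta,\varphi$ and $\psi,\Gamma\Rightarrow\Delta$ / $\varphi\to\psi,\Gamma\Rightarrow\Delta$; $(\Rightarrow\to)$ $\varphi,\Gamma\Rightarrow\Delta,\psi$ / $\Gamma\Rightarrow\Delta,\varphi\to\psi$. - $(\leftrightarrow\Rightarrow)$ $\Gamma\Rightarrow\Delta,\varphi,\psi$ and $\varphi,\psi,\Gamma\Rightarrow\Delta$ / $\varphi\leftrightarrow\psi,\Gamma\Rightarrow\Delta$; $(\Rightarrow\leftrightarrow)$ $\varphi,\Gamma\Rightarrow\Delta,\psi$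 and $\psi,\Gamma\Rightarrow\Delta,\varphi$ / $\Gamma\Rightarrow\Delta,\varphi\leftrightarrow\psi$. - $(\forall\Rightarrow)$ $\varphi^x_b,\Gamma\Rightarrow\Delta$ / $\forall x\varphi,\Gamma\Rightarrow\Delta$; $(\Rightarrow\forall)$ $\Gamma\Rightarrow\Delta,\varphi^x_a$ / $\Gamma\Rightarrow\Delta,\forall x\varphi$; $(\exists\Rightarrow)$ $\varphi^x_a,\Gamma\Rightarrow\Delta$ / $\exists x\varphi,\Gamma\Rightarrow\Delta$; $(\Rightarrow\exists)$ $\Gamma\Rightarrow\Delta,\varphi^x_b$ / $\Gamma\Rightarrow\Delta,\exists x\varphi$. - $(=+)$ $b=b,\Gamma\Rightarrow\Delta$ / $\Gamma\Rightarrow\Delta$; $(=-)$ $\mathscr A^x_c,\Gamma\Rightarrow\Delta$ / $b=c,\mathscr A^x_b,\Gamma\Rightarrow\Delta$ for atomic $\mathscr A$. - $(\lambda\Rightarrow)$ $\psi^x_b,\Gamma\Rightarrow\Delta$ / $(\lambda x\psi)b,\Gamma\Rightarrow\Delta$; $(\Rightarrow\lambda)$ $\Gamma\Rightarrow\Delta,\psi^x_b$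 / $\Gamma\Rightarrow\Delta,(\lambda x\psi)b$. - $(\iota_1\Rightarrow)$ $\varphi^y_a,\psi^x_a,\Gamma\Rightarrow\Delta$ / $(\lambda x\psi)\iota y\varphi,\Gamma\Rightarrow\Delta$; $(\iota_2\Rightarrow)$ $\Gamma\Rightarrow\Delta,\varphi^y_b$ and $\Gamma\Rightarrow\Delta,\varphi^y_c$ and $b=c,\Gamma\Rightarrow\Delta$ / $(\lambda x\psi)\iota y\varphi,\Gamma\Rightarrow\Delta$; $(\Rightarrow\iota)$ $\Gamma\Rightarrow\Delta,\varphi^y_b$ and $\Gamma\Rightarrow\Delta,\psi^x_b$ and $\varphi^y_a,\Gamma\Rightarrow\Delta,a=b$ / $\Gamma\Rightarrow\Delta,(\lambda x\psi)\iota y\varphi$. - $(=^2\Rightarrow)$ $\Gamma\Rightarrow\Delta,X(b_1,\dots,b_n),Y(b_1,\dots,b_n)$ and $X(b_1,\dots,b_n),Y(b_1,\dots,b_n),\Gamma\Rightarrow\Delta$ / $X=Y,\Gamma\Rightarrow\Delta$; $(\Rightarrow=^2)$ $X(a_1,\dots,a_n),\Gamma\Rightarrow\Delta,Y(a_1,\dots,a_n)$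 and $Y(a_1,\dots,a_n),\Gamma\Rightarrow\Delta,X(a_1,\dots,a_n)$ / $\Gamma\Rightarrow\Delta,X=Y$. - The rules $(\forall^2\Rightarrow),(\Rightarrow\forall^2),(\exists^2\Rightarrow),(\Rightarrow\exists^2),(\iota^2_1\Rightarrow),(\iota^2_2\Rightarrow),(\Rightarrow\iota^2)$, obtained from the corresponding first-order rules by replacing $x,y,a,b,c$ with $X,Y,A,B,C$ (all of the same arity). A derivation of a sequent is a finite tree of sequents with that sequent at the root in which every node follows from its immediate predecessors by a rule (leaves being axioms); it is cut-free if (Cut) is not used. **Theorem (cut admissibility).** For every sequent $\Gamma\Rightarrow\Delta$: if $\Gamma\Rightarrow\Delta$ has a derivation in $\mathbf{RLL}$, then it has a cut-free derivation in $\mathbf{RLL}$. The same holds when only formulas in which no (individual or relational) variable occurs free are allowed in sequents and derivations. -/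

import Mathlib

namespace RLL

universe u

/-- The non-logical symbols: individual constants, predicate symbols with their arities, and
relational constants with their (positive) arities. Each of the types may be empty. -/
structure Signature where
  Con : Type u
  Pred : ℕ → Type u
  RCon : ℕ+ → Type u

/-- Terms: individual variables, individual parameters and individual constants. Variables and
parameters form two disjoint countably infinite supplies of symbols. -/
inductive Term (L : Signature.{u}) : Type u
  | var (x : ℕ) : Term L
  | par (a : ℕ) : Term L
  | con (k : L.Con) : Term L

/-- Relational variables, parameters and constants of arity `n`; there are countably many
variables and countably many parameters of each arity `n ≥ 1`. These are not terms. -/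
inductive RTerm (L : Signature.{u}) (n : ℕ+) : Type u
  | var (X : ℕ) : RTerm L n
  | par (A : ℕ) : RTerm L n
  | con (K : L.RCon n) : RTerm L n

/-- Formulas of the second-order language.
* `lam x ψ t` is the lambda atom `(λx ψ) t` for a term `t`;
* `lamIota x ψ y φ` is the lambda atom `(λx ψ) ιy φ` (`x` is bound in `ψ` only, `y` in `φ` only);
* `lamIota₂ n X ψ Y φ` is `(λX ψ) ιY φ` for `n`-ary relational variables `X`, `Y`. -/
inductive Formula (L : Signature.{u}) : Type u
  | eq (s t : Term L) : Formula L
  | pred {n : ℕ} (P : L.Pred n) (ts : Fin n → Term L) : Formula L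
  | relEq {n : ℕ+} (X Y : RTerm L n) : Formula L
  | rel {n : ℕ+} (X : RTerm L n) (ts : Fin n → Term L) : Formula L
  | neg (φ : Formula L) : Formula L
  | and (φ ψ : Formula L) : Formula L
  | or (φ ψ : Formula L) : Formula L
  | imp (φ ψ : Formula L) : Formula L
  | iff (φ ψ : Formula L) : Formula L
  | all (x : ℕ) (φ : Formula L) : Formula L
  | ex (x : ℕ) (φ : Formula L) : Formula L
  | all₂ (n : ℕ+) (X : ℕ) (φ : Formula L) : Formula L
  | ex₂ (n : ℕ+) (X : ℕ) (φ : Formula L) : Formula L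
  | lam (x : ℕ) (ψ : Formula L) (t : Term L) : Formula L
  | lamIota (x : ℕ) (ψ : Formula L) (y : ℕ) (φ : Formula L) : Formula L
  | lamIota₂ (n : ℕ+) (X : ℕ) (ψ : Formula L) (Y : ℕ) (φ : Formula L) : Formula L

variable {L : Signature.{u}}

/-- Replace the variable `x` by the parameter `b`. -/
def Term.subst (x b : ℕ) : Term L → Term L
  | .var y => if y = x then .par b else .var y
  | .par a => .par a
  | .con k => .con k

/-- Replace the `n`-ary relational variable `X` by the `n`-ary relational parameter `B`. -/
def RTerm.subst (n : ℕ+) (X B : ℕ) {m : ℕ+} : RTerm L m → RTerm L m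
  | .var Y => if m = n ∧ Y = X then .par B else .var Y
  | .par A => .par A
  | .con K => .con K

namespace Formula

/-- `φ.subst x b` replaces the free occurrences of the individual variable `x` in `φ` by the
individual parameter `b`. Parameters are never bound, so nothing can be captured. -/
def subst (x b : ℕ) : Formula L → Formula L
  | eq s t => eq (s.subst x b) (t.subst x b)
  | pred P ts => pred P (fun i => (ts i).subst x b)
  | relEq X Y => relEq X Y
  | rel X ts => rel X (fun i => (ts i).subst x b)
  | neg φ => neg (φ.subst x b)
  | and φ ψ => and (φ.subst x b) (ψ.subst x b)
  | or φ ψ => or (φ.subst x b) (ψ.subst x b)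
  | imp φ ψ => imp (φ.subst x b) (ψ.subst x b)
  | iff φ ψ => iff (φ.subst x b) (ψ.subst x b)
  | all y φ => all y (if y = x then φ else φ.subst x b)
  | ex y φ => ex y (if y = x then φ else φ.subst x b)
  | all₂ n X φ => all₂ n X (φ.subst x b)
  | ex₂ n X φ => ex₂ n X (φ.subst x b)
  | lam y ψ t => lam y (if y = x then ψ else ψ.subst x b) (t.subst x b)
  | lamIota y ψ z φ =>
      lamIota y (if y = x then ψ else ψ.subst x b) z (if z = x then φ else φ.subst x b)
  | lamIota₂ n X ψ Y φ => lamIota₂ n X (ψ.subst x b) Y (φ.subst x b)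

/-- `φ.subst₂ n X B` replaces the free occurrences of the `n`-ary relational variable `X` in `φ`
by the `n`-ary relational parameter `B`. -/
def subst₂ (n : ℕ+) (X B : ℕ) : Formula L → Formula L
  | eq s t => eq s t
  | pred P ts => pred P ts
  | relEq Y Z => relEq (Y.subst n X B) (Z.subst n X B)
  | rel Y ts => rel (Y.subst n X B) ts
  | neg φ => neg (φ.subst₂ n X B)
  | and φ ψ => and (φ.subst₂ n X B) (ψ.subst₂ n X B)
  | or φ ψ => or (φ.subst₂ n X B) (ψ.subst₂ n X B)
  | imp φ ψ => imp (φ.subst₂ n X B) (ψ.subst₂ n X B)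
  | iff φ ψ => iff (φ.subst₂ n X B) (ψ.subst₂ n X B)
  | all y φ => all y (φ.subst₂ n X B)
  | ex y φ => ex y (φ.subst₂ n X B)
  | all₂ m Y φ => all₂ m Y (if m = n ∧ Y = X then φ else φ.subst₂ n X B)
  | ex₂ m Y φ => ex₂ m Y (if m = n ∧ Y = X then φ else φ.subst₂ n X B)
  | lam y ψ t => lam y (ψ.subst₂ n X B) t
  | lamIota y ψ z φ => lamIota y (ψ.subst₂ n X B) z (φ.subst₂ n X B)
  | lamIota₂ m Y ψ Z φ =>
      lamIota₂ m Y (if m = n ∧ Y = X then ψ else ψ.subst₂ n X B)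
        Z (if m = n ∧ Z = X then φ else φ.subst₂ n X B)

/-- The individual parameter `a` occurs in the formula. -/
def HasPar (a : ℕ) : Formula L → Prop
  | eq s t => s = .par a ∨ t = .par a
  | pred _ ts => ∃ i, ts i = .par a
  | relEq _ _ => False
  | rel _ ts => ∃ i, ts i = .par a
  | neg φ => φ.HasPar a
  | and φ ψ => φ.HasPar a ∨ ψ.HasPar a
  | or φ ψ => φ.HasPar a ∨ ψ.HasPar a
  | imp φ ψ => φ.HasPar a ∨ ψ.HasPar a
  | iff φ ψ => φ.HasPar a ∨ ψ.HasPar a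
  | all _ φ => φ.HasPar a
  | ex _ φ => φ.HasPar a
  | all₂ _ _ φ => φ.HasPar a
  | ex₂ _ _ φ => φ.HasPar a
  | lam _ ψ t => ψ.HasPar a ∨ t = .par a
  | lamIota _ ψ _ φ => ψ.HasPar a ∨ φ.HasPar a
  | lamIota₂ _ _ ψ _ φ => ψ.HasPar a ∨ φ.HasPar a

/-- The `n`-ary relational parameter `A` occurs in the formula. -/
def HasRPar (n : ℕ+) (A : ℕ) : Formula L → Prop
  | eq _ _ => False
  | pred _ _ => False
  | @relEq _ m X Y => m = n ∧ (X = .par A ∨ Y = .par A)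
  | @rel _ m X _ => m = n ∧ X = .par A
  | neg φ => φ.HasRPar n A
  | and φ ψ => φ.HasRPar n A ∨ ψ.HasRPar n A
  | or φ ψ => φ.HasRPar n A ∨ ψ.HasRPar n A
  | imp φ ψ => φ.HasRPar n A ∨ ψ.HasRPar n A
  | iff φ ψ => φ.HasRPar n A ∨ ψ.HasRPar n A
  | all _ φ => φ.HasRPar n A
  | ex _ φ => φ.HasRPar n A
  | all₂ _ _ φ => φ.HasRPar n A
  | ex₂ _ _ φ => φ.HasRPar n A
  | lam _ ψ _ => ψ.HasRPar n A
  | lamIota _ ψ _ φ => ψ.HasRPar n A ∨ φ.HasRPar n A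
  | lamIota₂ _ _ ψ _ φ => ψ.HasRPar n A ∨ φ.HasRPar n A

/-- The individual variable `x` occurs free in the formula. -/
def FreeVar (x : ℕ) : Formula L → Prop
  | eq s t => s = .var x ∨ t = .var x
  | pred _ ts => ∃ i, ts i = .var x
  | relEq _ _ => False
  | rel _ ts => ∃ i, ts i = .var x
  | neg φ => φ.FreeVar x
  | and φ ψ => φ.FreeVar x ∨ ψ.FreeVar x
  | or φ ψ => φ.FreeVar x ∨ ψ.FreeVar x
  | imp φ ψ => φ.FreeVar x ∨ ψ.FreeVar x
  | iff φ ψ => φ.FreeVar x ∨ ψ.FreeVar x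
  | all y φ => y ≠ x ∧ φ.FreeVar x
  | ex y φ => y ≠ x ∧ φ.FreeVar x
  | all₂ _ _ φ => φ.FreeVar x
  | ex₂ _ _ φ => φ.FreeVar x
  | lam y ψ t => (y ≠ x ∧ ψ.FreeVar x) ∨ t = .var x
  | lamIota y ψ z φ => (y ≠ x ∧ ψ.FreeVar x) ∨ (z ≠ x ∧ φ.FreeVar x)
  | lamIota₂ _ _ ψ _ φ => ψ.FreeVar x ∨ φ.FreeVar x

/-- The `n`-ary relational variable `X` occurs free in the formula. -/
def FreeRVar (n : ℕ+) (X : ℕ) : Formula L → Prop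
  | eq _ _ => False
  | pred _ _ => False
  | @relEq _ m Y Z => m = n ∧ (Y = .var X ∨ Z = .var X)
  | @rel _ m Y _ => m = n ∧ Y = .var X
  | neg φ => φ.FreeRVar n X
  | and φ ψ => φ.FreeRVar n X ∨ ψ.FreeRVar n X
  | or φ ψ => φ.FreeRVar n X ∨ ψ.FreeRVar n X
  | imp φ ψ => φ.FreeRVar n X ∨ ψ.FreeRVar n X
  | iff φ ψ => φ.FreeRVar n X ∨ ψ.FreeRVar n X
  | all _ φ => φ.FreeRVar n X
  | ex _ φ => φ.FreeRVar n X
  | all₂ m Y φ => ¬(m = n ∧ Y = X) ∧ φ.FreeRVar n X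
  | ex₂ m Y φ => ¬(m = n ∧ Y = X) ∧ φ.FreeRVar n X
  | lam _ ψ _ => ψ.FreeRVar n X
  | lamIota _ ψ _ φ => ψ.FreeRVar n X ∨ φ.FreeRVar n X
  | lamIota₂ m Y ψ Z φ =>
      (¬(m = n ∧ Y = X) ∧ ψ.FreeRVar n X) ∨ (¬(m = n ∧ Z = X) ∧ φ.FreeRVar n X)

/-- All variables of the formula, individual and relational, are bound (free places are taken by
parameters and constants only). -/
def VarsBound (φ : Formula L) : Prop :=
  (∀ x, ¬ φ.FreeVar x) ∧ ∀ n X, ¬ φ.FreeRVar n X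

/-- Atomic formulas: `s = t`, `P(t₁,…,tₙ)`, `X = Y`, `X(t₁,…,tₙ)`. -/
def IsAtomic : Formula L → Prop
  | eq _ _ => True
  | pred _ _ => True
  | relEq _ _ => True
  | rel _ _ => True
  | _ => False

end Formula

/-- A sequent `Γ ⟹ Δ`: a pair of finite multisets of formulas. -/
structure Sequent (L : Signature.{u}) where
  ante : Multiset (Formula L)
  succ : Multiset (Formula L)

infix:45 "⟹" => Sequent.mk

/-- No variable occurs free in the sequent. -/
def Sequent.VarsBound (S : Sequent L) : Prop :=
  (∀ φ ∈ S.ante, φ.VarsBound) ∧ ∀ φ ∈ S.succ, φ.VarsBound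

/-- The individual parameter `a` does not occur in the formulas of `Γ`. -/
def Fresh (a : ℕ) (Γ : Multiset (Formula L)) : Prop := ∀ φ ∈ Γ, ¬ φ.HasPar a

/-- The `n`-ary relational parameter `A` does not occur in the formulas of `Γ`. -/
def Fresh₂ (n : ℕ+) (A : ℕ) (Γ : Multiset (Formula L)) : Prop := ∀ φ ∈ Γ, ¬ φ.HasRPar n A

open Formula

/-- All rules except Cut: `Rule ps S` says that `S` follows from the list `ps` of premises by one
application of a rule. `a` (`A`) denotes an eigenvariable, `b`, `c` (`B`, `C`) arbitrary
individual (relational) parameters. -/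
inductive Rule : List (Sequent L) → Sequent L → Prop
  -- axiom and structural rules
  | ax φ : Rule [] ({φ} ⟹ {φ})
  | weakL Γ Δ φ : Rule [Γ ⟹ Δ] (φ ::ₘ Γ ⟹ Δ)
  | weakR Γ Δ φ : Rule [Γ ⟹ Δ] (Γ ⟹ φ ::ₘ Δ)
  | contrL Γ Δ φ : Rule [φ ::ₘ φ ::ₘ Γ ⟹ Δ] (φ ::ₘ Γ ⟹ Δ)
  | contrR Γ Δ φ : Rule [Γ ⟹ φ ::ₘ φ ::ₘ Δ] (Γ ⟹ φ ::ₘ Δ)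
  -- propositional rules
  | andL Γ Δ φ ψ : Rule [φ ::ₘ ψ ::ₘ Γ ⟹ Δ] (and φ ψ ::ₘ Γ ⟹ Δ)
  | andR Γ Δ φ ψ : Rule [Γ ⟹ φ ::ₘ Δ, Γ ⟹ ψ ::ₘ Δ] (Γ ⟹ and φ ψ ::ₘ Δ)
  | negL Γ Δ φ : Rule [Γ ⟹ φ ::ₘ Δ] (neg φ ::ₘ Γ ⟹ Δ)
  | negR Γ Δ φ : Rule [φ ::ₘ Γ ⟹ Δ] (Γ ⟹ neg φ ::ₘ Δ)
  | orL Γ Δ φ ψ : Rule [φ ::ₘ Γ ⟹ Δ, ψ ::ₘ Γ ⟹ Δ] (or φ ψ ::ₘ Γ ⟹ Δ)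
  | orR Γ Δ φ ψ : Rule [Γ ⟹ φ ::ₘ ψ ::ₘ Δ] (Γ ⟹ or φ ψ ::ₘ Δ)
  | impL Γ Δ φ ψ : Rule [Γ ⟹ φ ::ₘ Δ, ψ ::ₘ Γ ⟹ Δ] (imp φ ψ ::ₘ Γ ⟹ Δ)
  | impR Γ Δ φ ψ : Rule [φ ::ₘ Γ ⟹ ψ ::ₘ Δ] (Γ ⟹ imp φ ψ ::ₘ Δ)
  | iffL Γ Δ φ ψ :
      Rule [Γ ⟹ φ ::ₘ ψ ::ₘ Δ, φ ::ₘ ψ ::ₘ Γ ⟹ Δ] (iff φ ψ ::ₘ Γ ⟹ Δ)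
  | iffR Γ Δ φ ψ :
      Rule [φ ::ₘ Γ ⟹ ψ ::ₘ Δ, ψ ::ₘ Γ ⟹ φ ::ₘ Δ] (Γ ⟹ iff φ ψ ::ₘ Δ)
  -- first-order quantifiers
  | allL Γ Δ x φ b : Rule [φ.subst x b ::ₘ Γ ⟹ Δ] (all x φ ::ₘ Γ ⟹ Δ)
  | allR Γ Δ x φ a : Fresh a Γ → Fresh a Δ → ¬ φ.HasPar a →
      Rule [Γ ⟹ φ.subst x a ::ₘ Δ] (Γ ⟹ all x φ ::ₘ Δ)
  | exL Γ Δ x φ a : Fresh a Γ → Fresh a Δ → ¬ φ.HasPar a →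
      Rule [φ.subst x a ::ₘ Γ ⟹ Δ] (ex x φ ::ₘ Γ ⟹ Δ)
  | exR Γ Δ x φ b : Rule [Γ ⟹ φ.subst x b ::ₘ Δ] (Γ ⟹ ex x φ ::ₘ Δ)
  -- first-order identity
  | eqPlus Γ Δ b : Rule [eq (.par b) (.par b) ::ₘ Γ ⟹ Δ] (Γ ⟹ Δ)
  | eqMinus Γ Δ x b c (φ : Formula L) : φ.IsAtomic →
      Rule [φ.subst x c ::ₘ Γ ⟹ Δ] (eq (.par b) (.par c) ::ₘ φ.subst x b ::ₘ Γ ⟹ Δ)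
  -- first-order lambda atoms and descriptions
  | lamL Γ Δ x ψ b : Rule [ψ.subst x b ::ₘ Γ ⟹ Δ] (lam x ψ (.par b) ::ₘ Γ ⟹ Δ)
  | lamR Γ Δ x ψ b : Rule [Γ ⟹ ψ.subst x b ::ₘ Δ] (Γ ⟹ lam x ψ (.par b) ::ₘ Δ)
  | iotaL₁ Γ Δ x ψ y φ a : Fresh a Γ → Fresh a Δ → ¬ φ.HasPar a → ¬ ψ.HasPar a →
      Rule [φ.subst y a ::ₘ ψ.subst x a ::ₘ Γ ⟹ Δ] (lamIota x ψ y φ ::ₘ Γ ⟹ Δ)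
  | iotaL₂ Γ Δ x ψ y φ b c :
      Rule [Γ ⟹ φ.subst y b ::ₘ Δ, Γ ⟹ φ.subst y c ::ₘ Δ, eq (.par b) (.par c) ::ₘ Γ ⟹ Δ]
        (lamIota x ψ y φ ::ₘ Γ ⟹ Δ)
  | iotaR Γ Δ x ψ y φ b a : Fresh a Γ → Fresh a Δ → ¬ φ.HasPar a → a ≠ b →
      Rule [Γ ⟹ φ.subst y b ::ₘ Δ, Γ ⟹ ψ.subst x b ::ₘ Δ,
          φ.subst y a ::ₘ Γ ⟹ eq (.par a) (.par b) ::ₘ Δ]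
        (Γ ⟹ lamIota x ψ y φ ::ₘ Δ)
  -- second-order identity
  | relEqL Γ Δ (n : ℕ+) (X Y : RTerm L n) (b : Fin n → ℕ) :
      Rule [Γ ⟹ rel X (fun i => .par (b i)) ::ₘ rel Y (fun i => .par (b i)) ::ₘ Δ,
          rel X (fun i => .par (b i)) ::ₘ rel Y (fun i => .par (b i)) ::ₘ Γ ⟹ Δ]
        (relEq X Y ::ₘ Γ ⟹ Δ)
  | relEqR Γ Δ (n : ℕ+) (X Y : RTerm L n) (a : Fin n → ℕ) : Function.Injective a →
      (∀ i, Fresh (a i) Γ) → (∀ i, Fresh (a i) Δ) →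
      Rule [rel X (fun i => .par (a i)) ::ₘ Γ ⟹ rel Y (fun i => .par (a i)) ::ₘ Δ,
          rel Y (fun i => .par (a i)) ::ₘ Γ ⟹ rel X (fun i => .par (a i)) ::ₘ Δ]
        (Γ ⟹ relEq X Y ::ₘ Δ)
  -- second-order quantifiers
  | allL₂ Γ Δ n X φ B : Rule [φ.subst₂ n X B ::ₘ Γ ⟹ Δ] (all₂ n X φ ::ₘ Γ ⟹ Δ)
  | allR₂ Γ Δ n X φ A : Fresh₂ n A Γ → Fresh₂ n A Δ → ¬ φ.HasRPar n A →
      Rule [Γ ⟹ φ.subst₂ n X A ::ₘ Δ] (Γ ⟹ all₂ n X φ ::ₘ Δ)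
  | exL₂ Γ Δ n X φ A : Fresh₂ n A Γ → Fresh₂ n A Δ → ¬ φ.HasRPar n A →
      Rule [φ.subst₂ n X A ::ₘ Γ ⟹ Δ] (ex₂ n X φ ::ₘ Γ ⟹ Δ)
  | exR₂ Γ Δ n X φ B : Rule [Γ ⟹ φ.subst₂ n X B ::ₘ Δ] (Γ ⟹ ex₂ n X φ ::ₘ Δ)
  -- second-order descriptions
  | iotaL₁₂ Γ Δ n X ψ Y φ A :
      Fresh₂ n A Γ → Fresh₂ n A Δ → ¬ φ.HasRPar n A → ¬ ψ.HasRPar n A →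
      Rule [φ.subst₂ n Y A ::ₘ ψ.subst₂ n X A ::ₘ Γ ⟹ Δ] (lamIota₂ n X ψ Y φ ::ₘ Γ ⟹ Δ)
  | iotaL₂₂ Γ Δ n X ψ Y φ B C :
      Rule [Γ ⟹ φ.subst₂ n Y B ::ₘ Δ, Γ ⟹ φ.subst₂ n Y C ::ₘ Δ,
          relEq (n := n) (.par B) (.par C) ::ₘ Γ ⟹ Δ]
        (lamIota₂ n X ψ Y φ ::ₘ Γ ⟹ Δ)
  | iotaR₂ Γ Δ n X ψ Y φ B A :
      Fresh₂ n A Γ → Fresh₂ n A Δ → ¬ φ.HasRPar n A → A ≠ B →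
      Rule [Γ ⟹ φ.subst₂ n Y B ::ₘ Δ, Γ ⟹ ψ.subst₂ n X B ::ₘ Δ,
          φ.subst₂ n Y A ::ₘ Γ ⟹ relEq (n := n) (.par A) (.par B) ::ₘ Δ]
        (Γ ⟹ lamIota₂ n X ψ Y φ ::ₘ Δ)

/-- The Cut rule. -/
inductive CutRule : List (Sequent L) → Sequent L → Prop
  | cut Γ Δ Pi Sg φ : CutRule [Γ ⟹ φ ::ₘ Δ, φ ::ₘ Pi ⟹ Sg] (Γ + Pi ⟹ Δ + Sg)

/-- `Derivable R S`: there is a finite tree of sequents with root `S` each of whose nodes follows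
from its immediate predecessors by `R` (leaves are conclusions of `R` without premises). -/
inductive Derivable (R : List (Sequent L) → Sequent L → Prop) : Sequent L → Prop
  | node (ps : List (Sequent L)) (S : Sequent L) :
      R ps S → (∀ P ∈ ps, Derivable R P) → Derivable R S

/-- There is a derivation in RLL, Cut allowed. -/
def Provable (S : Sequent L) : Prop :=
  Derivable (fun ps T => Rule ps T ∨ CutRule ps T) S

/-- There is a cut-free derivation in RLL. -/
def CutFreeProvable (S : Sequent L) : Prop :=
  Derivable Rule S

/-- There is a derivation in RLL, Cut allowed, in whose sequents no variable occurs free. -/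
def ProvableBound (S : Sequent L) : Prop :=
  Derivable (fun ps T => (Rule ps T ∨ CutRule ps T) ∧ T.VarsBound) S

/-- There is a cut-free derivation in RLL in whose sequents no variable occurs free. -/
def CutFreeProvableBound (S : Sequent L) : Prop :=
  Derivable (fun ps T => Rule ps T ∧ T.VarsBound) S

end RLL

/-!
Cut elimination is carried out in a variant of RLL without eigenvariables: a rule with an
eigenvariable gets one premise for every parameter, and a premise repeats the whole conclusion, so
that weakening and contraction are absorbed. In the reduction of a principal cut the premise with
the required parameter is then already present, and no parameter has to be substituted into a
derivation.

Soundness of the eigenvariable rules in this calculus needs a stronger induction hypothesis: all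
instances of a provable sequent under renamings of parameters are derivable. In the opposite
direction, a rule with a premise for every parameter is applied with the premise of a fresh one.
Finally, read upwards, the rules other than Cut introduce no free variables, so that a cut-free
derivation of a sequent without free variables contains none.
-/

namespace RLL

universe u

/-! ### Cut elimination for cumulative calculi -/

/-- The formulas that a premise of a rule adds to the antecedent and to the succedent of the
conclusion. -/
abbrev Premise (F : Type*) := Multiset F × Multiset F

/-- The rules of a two-sided calculus over a type `F` of formulas. They are used cumulatively: a
premise contains the whole conclusion, and a rule may have infinitely many premises.
* `right φ I` and `left φ I`: a succedent, respectively antecedent, formula `φ` is inferred from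
  the premises `I`;
* `ante A χ`: the formula `χ` is dropped from an antecedent that contains `A`. -/
structure CumulativeCalculus (F : Type*) where
  right : F → Set (Premise F) → Prop
  left : F → Set (Premise F) → Prop
  ante : Multiset F → F → Prop
  not_right_of_ante {A : Multiset F} {χ φ : F} {I : Set (Premise F)} :
    ante A χ → φ ∈ A → ¬ right φ I

namespace CumulativeCalculus

variable {F : Type*}

/-- Derivability without cut. -/
inductive Derives (C : CumulativeCalculus F) : Multiset F → Multiset F → Prop
  | ax {Γ Δ φ} : φ ∈ Γ → φ ∈ Δ → Derives C Γ Δ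
  | right {Γ Δ φ I} : C.right φ I → φ ∈ Δ → (∀ p ∈ I, Derives C (p.1 + Γ) (p.2 + Δ)) →
      Derives C Γ Δ
  | left {Γ Δ φ I} : C.left φ I → φ ∈ Γ → (∀ p ∈ I, Derives C (p.1 + Γ) (p.2 + Δ)) →
      Derives C Γ Δ
  | ante {Γ Δ A χ} : C.ante A χ → A ⊆ Γ → Derives C (χ ::ₘ Γ) Δ → Derives C Γ Δ

variable {C : CumulativeCalculus F} {Γ Γ' Γ₁ Γ₂ Δ Δ' Δ₁ Δ₂ : Multiset F} {φ ψ : F}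
  {I : Set (Premise F)}

namespace Derives

theorem weaken (h : C.Derives Γ Δ) (hΓ : Γ ⊆ Γ' := by grind [Multiset.subset_iff])
    (hΔ : Δ ⊆ Δ' := by grind [Multiset.subset_iff]) : C.Derives Γ' Δ' := by
  induction h generalizing Γ' Δ' with
  | ax hφΓ hφΔ => exact .ax (hΓ hφΓ) (hΔ hφΔ)
  | right hI hφ _ ih =>
    exact .right hI (hΔ hφ) fun p hp => by apply ih p hp <;> grind [Multiset.subset_iff]
  | left hI hφ _ ih =>
    exact .left hI (hΓ hφ) fun p hp => by apply ih p hp <;> grind [Multiset.subset_iff]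
  | ante hA hAΓ _ ih =>
    exact .ante hA (Multiset.Subset.trans hAΓ hΓ) (ih (Multiset.cons_subset_cons hΓ) hΔ)

theorem right_cons (hI : C.right φ I) (h : ∀ p ∈ I, C.Derives (p.1 + Γ) (p.2 + Δ)) :
    C.Derives Γ (φ ::ₘ Δ) :=
  .right hI (Multiset.mem_cons_self φ Δ) fun p hp => (h p hp).weaken

theorem left_cons (hI : C.left φ I) (h : ∀ p ∈ I, C.Derives (p.1 + Γ) (p.2 + Δ)) :
    C.Derives (φ ::ₘ Γ) Δ :=
  .left hI (Multiset.mem_cons_self φ Γ) fun p hp => (h p hp).weaken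

theorem elim_succ (h : C.Derives Γ₁ Δ₁) (hax : C.Derives (φ ::ₘ Γ) Δ)
    (hright : ∀ Γ' Δ' I, Γ ⊆ Γ' → Δ ⊆ Δ' → C.right φ I →
      (∀ p ∈ I, C.Derives (p.1 + Γ') (p.2 + Δ')) → C.Derives Γ' Δ')
    (hΓ : Γ ⊆ Γ') (hΔ : Δ ⊆ Δ') (hΓ₁ : Γ₁ ⊆ Γ') (hΔ₁ : Δ₁ ⊆ φ ::ₘ Δ') : C.Derives Γ' Δ' := by
  induction h generalizing Γ' Δ' with
  | ax hχΓ hχΔ =>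
    rcases Multiset.mem_cons.1 (hΔ₁ hχΔ) with rfl | hχΔ'
    · exact hax.weaken
    · exact .ax (hΓ₁ hχΓ) hχΔ'
  | @right _ _ _ I' hI hχ _ ih =>
    have hprem : ∀ p ∈ I', C.Derives (p.1 + Γ') (p.2 + Δ') := fun p hp => by
      apply ih p hp <;> grind [Multiset.subset_iff]
    rcases Multiset.mem_cons.1 (hΔ₁ hχ) with rfl | hχΔ'
    · exact hright _ _ _ hΓ hΔ hI hprem
    · exact .right hI hχΔ' hprem
  | left hI hχ _ ih =>
    exact .left hI (hΓ₁ hχ) fun p hp => by apply ih p hp <;> grind [Multiset.subset_iff]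
  | ante hA hAΓ _ ih =>
    exact .ante hA (Multiset.Subset.trans hAΓ hΓ₁) (by apply ih <;> grind [Multiset.subset_iff])

theorem elim_ante (h : C.Derives Γ₁ Δ₁) (hax : C.Derives Γ (φ ::ₘ Δ))
    (hante : ∀ A χ, C.ante A χ → φ ∉ A)
    (hleft : ∀ Γ' Δ' J, Γ ⊆ Γ' → Δ ⊆ Δ' → C.left φ J →
      (∀ p ∈ J, C.Derives (p.1 + Γ') (p.2 + Δ')) → C.Derives Γ' Δ')
    (hΓ : Γ ⊆ Γ') (hΔ : Δ ⊆ Δ') (hΓ₁ : Γ₁ ⊆ φ ::ₘ Γ') (hΔ₁ : Δ₁ ⊆ Δ') : C.Derives Γ' Δ' := by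
  induction h generalizing Γ' Δ' with
  | ax hχΓ hχΔ =>
    rcases Multiset.mem_cons.1 (hΓ₁ hχΓ) with rfl | hχΓ'
    · exact hax.weaken
    · exact .ax hχΓ' (hΔ₁ hχΔ)
  | right hI hχ _ ih =>
    exact .right hI (hΔ₁ hχ) fun p hp => by apply ih p hp <;> grind [Multiset.subset_iff]
  | @left _ _ _ I' hI hχ _ ih =>
    have hprem : ∀ p ∈ I', C.Derives (p.1 + Γ') (p.2 + Δ') := fun p hp => by
      apply ih p hp <;> grind [Multiset.subset_iff]
    rcases Multiset.mem_cons.1 (hΓ₁ hχ) with rfl | hχΓ'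
    · exact hleft _ _ _ hΓ hΔ hI hprem
    · exact .left hI hχΓ' hprem
  | ante hA hAΓ _ ih =>
    have hφA := hante _ _ hA
    exact .ante hA (by grind [Multiset.subset_iff])
      (by apply ih <;> grind [Multiset.subset_iff])

end Derives

/-- Cuts on `φ` are admissible. -/
def CutAdmissible (C : CumulativeCalculus F) (φ : F) : Prop :=
  ∀ ⦃Γ Δ⦄, C.Derives Γ (φ ::ₘ Δ) → C.Derives (φ ::ₘ Γ) Δ → C.Derives Γ Δ

/-- Principal cuts on `φ`, those between a right and a left rule for `φ`, can be removed. -/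
def Reducible (C : CumulativeCalculus F) (φ : F) : Prop :=
  ∀ ⦃Γ Δ I J⦄, C.right φ I → C.left φ J → (∀ p ∈ I, C.Derives (p.1 + Γ) (p.2 + Δ)) →
    (∀ p ∈ J, C.Derives (p.1 + Γ) (p.2 + Δ)) → C.Derives Γ Δ

theorem Reducible.cutAdmissible (hφ : C.Reducible φ) : C.CutAdmissible φ := by
  intro Γ Δ hsucc hante
  refine hsucc.elim_succ hante (fun Γ₁ Δ₁ I hΓ₁ hΔ₁ hI hp => ?_) (Multiset.Subset.refl _)
    (Multiset.Subset.refl _) (Multiset.Subset.refl _) (Multiset.Subset.refl _)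
  refine hante.elim_ante (.right_cons hI hp) (fun A χ hA hφA => C.not_right_of_ante hA hφA hI)
    (fun Γ₂ Δ₂ J hΓ₂ hΔ₂ hJ hq => ?_) (Multiset.Subset.refl _) (Multiset.Subset.refl _)
    (Multiset.cons_subset_cons hΓ₁) hΔ₁
  exact hφ hI hJ (fun p hpI => (hp p hpI).weaken) hq

theorem cutAdmissible_of_reducible {α : Type*} [LT α] [WellFoundedLT α] (deg : F → α)
    (h : ∀ φ, (∀ χ, deg χ < deg φ → C.CutAdmissible χ) → C.Reducible φ) (φ : F) :
    C.CutAdmissible φ :=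
  (InvImage.wf deg wellFounded_lt).induction φ fun φ ih => (h φ ih).cutAdmissible

namespace CutAdmissible

theorem cut (hφ : C.CutAdmissible φ) (h₁ : C.Derives Γ₁ Δ₁) (h₂ : C.Derives Γ₂ Δ₂)
    (hΓ₁ : Γ₁ ⊆ Γ := by grind [Multiset.subset_iff])
    (hΔ₁ : Δ₁ ⊆ φ ::ₘ Δ := by grind [Multiset.subset_iff])
    (hΓ₂ : Γ₂ ⊆ φ ::ₘ Γ := by grind [Multiset.subset_iff])
    (hΔ₂ : Δ₂ ⊆ Δ := by grind [Multiset.subset_iff]) : C.Derives Γ Δ :=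
  hφ (h₁.weaken hΓ₁ hΔ₁) (h₂.weaken hΓ₂ hΔ₂)

theorem cut_conj (hφ : C.CutAdmissible φ) (hψ : C.CutAdmissible ψ)
    (h₁ : C.Derives Γ (φ ::ₘ Δ)) (h₂ : C.Derives Γ (ψ ::ₘ Δ))
    (h : C.Derives (φ ::ₘ ψ ::ₘ Γ) Δ) : C.Derives Γ Δ :=
  have hψΓ : C.Derives (ψ ::ₘ Γ) Δ := hφ.cut h₁ h
  hψ h₂ hψΓ

theorem cut_disj (hφ : C.CutAdmissible φ) (hψ : C.CutAdmissible ψ)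
    (h : C.Derives Γ (φ ::ₘ ψ ::ₘ Δ)) (h₁ : C.Derives (φ ::ₘ Γ) Δ)
    (h₂ : C.Derives (ψ ::ₘ Γ) Δ) : C.Derives Γ Δ :=
  have hψΔ : C.Derives Γ (ψ ::ₘ Δ) := hφ.cut h h₁
  hψ hψΔ h₂

theorem cut_imp (hφ : C.CutAdmissible φ) (hψ : C.CutAdmissible ψ)
    (h : C.Derives (φ ::ₘ Γ) (ψ ::ₘ Δ)) (h₁ : C.Derives Γ (φ ::ₘ Δ))
    (h₂ : C.Derives (ψ ::ₘ Γ) Δ) : C.Derives Γ Δ :=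
  have hψΔ : C.Derives Γ (ψ ::ₘ Δ) := hφ.cut h₁ h
  hψ hψΔ h₂

theorem cut_iff (hφ : C.CutAdmissible φ) (hψ : C.CutAdmissible ψ)
    (hφψ : C.Derives (φ ::ₘ Γ) (ψ ::ₘ Δ)) (hψφ : C.Derives (ψ ::ₘ Γ) (φ ::ₘ Δ))
    (h₁ : C.Derives Γ (φ ::ₘ ψ ::ₘ Δ)) (h₂ : C.Derives (φ ::ₘ ψ ::ₘ Γ) Δ) : C.Derives Γ Δ :=
  have hψΔ : C.Derives Γ (ψ ::ₘ Δ) := hφ.cut h₁ hφψ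
  have hφΔ : C.Derives Γ (φ ::ₘ Δ) := hψ.cut hψΔ hψφ
  cut_conj hφ hψ hφΔ hψΔ h₂

/-- For a description: if `β` and `γ` are two of its instances, `εβ` and `εγ` identify them with
the object described, and `ε` identifies them with each other. -/
theorem cut_unique {β γ εβ εγ ε : F} (hβ : C.CutAdmissible β) (hγ : C.CutAdmissible γ)
    (hεβ : C.CutAdmissible εβ) (hεγ : C.CutAdmissible εγ) (hε : C.CutAdmissible ε)
    (hβΓ : C.Derives (β ::ₘ Γ) (εβ ::ₘ Δ)) (hγΓ : C.Derives (γ ::ₘ Γ) (εγ ::ₘ Δ))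
    (hβΔ : C.Derives Γ (β ::ₘ Δ)) (hγΔ : C.Derives Γ (γ ::ₘ Δ)) (hεΓ : C.Derives (ε ::ₘ Γ) Δ)
    (htrans : C.Derives (εβ ::ₘ εγ ::ₘ Γ) (ε ::ₘ Δ)) : C.Derives Γ Δ :=
  have hεβΔ : C.Derives Γ (εβ ::ₘ Δ) := hβ.cut hβΔ hβΓ
  have hεγΔ : C.Derives Γ (εγ ::ₘ Δ) := hγ.cut hγΔ hγΓ
  cut_conj hεβ hεγ hεβΔ hεγΔ (hε.cut htrans hεΓ)

end CutAdmissible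

end CumulativeCalculus

/-! ### Renamings of parameters -/

variable {L : Signature.{u}}

/-- A renaming of the individual parameters and of the relational parameters of every arity. -/
structure Renaming where
  par : ℕ → ℕ
  rpar : ℕ+ → ℕ → ℕ

namespace Renaming

/-- The identity renaming. -/
protected def id : Renaming := ⟨id, fun _ => id⟩

/-- Modify `ρ` to send the individual parameter `a` to `b`. -/
def setPar (ρ : Renaming) (a b : ℕ) : Renaming :=
  { ρ with par := fun c => if c = a then b else ρ.par c }

/-- Modify `ρ` to send the individual parameters `a i`, assumed distinct, to `b i`. -/
noncomputable def setPars (ρ : Renaming) {n : ℕ} (a b : Fin n → ℕ) : Renaming :=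
  { ρ with par := Function.extend a b ρ.par }

/-- Modify `ρ` to send the `n`-ary relational parameter `A` to `B`. -/
def setRPar (ρ : Renaming) (n : ℕ+) (A B : ℕ) : Renaming :=
  { ρ with rpar := fun m C => if m = n ∧ C = A then B else ρ.rpar m C }

variable (ρ : Renaming)

theorem setPar_par_self (a b : ℕ) : (ρ.setPar a b).par a = b := if_pos rfl

theorem setPar_par_of_ne {a b c : ℕ} (h : c ≠ a) : (ρ.setPar a b).par c = ρ.par c := if_neg h

theorem setPars_par_apply {n : ℕ} {a : Fin n → ℕ} (ha : a.Injective) (b : Fin n → ℕ) (i : Fin n) :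
    (ρ.setPars a b).par (a i) = b i :=
  ha.extend_apply b ρ.par i

theorem setRPar_rpar_self (n : ℕ+) (A B : ℕ) : (ρ.setRPar n A B).rpar n A = B :=
  if_pos ⟨rfl, rfl⟩

theorem setRPar_rpar_of_ne {n : ℕ+} {A B C : ℕ} (h : C ≠ A) :
    (ρ.setRPar n A B).rpar n C = ρ.rpar n C :=
  if_neg fun ⟨_, hCA⟩ => h hCA

end Renaming

/-- Rename the parameters of a term. -/
def Term.rename (ρ : Renaming) : Term L → Term L
  | .var x => .var x
  | .par a => .par (ρ.par a)
  | .con k => .con k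

/-- Rename the parameters of a relational term. -/
def RTerm.rename (ρ : Renaming) {n : ℕ+} : RTerm L n → RTerm L n
  | .var X => .var X
  | .par A => .par (ρ.rpar n A)
  | .con K => .con K

/-- Rename the parameters of a formula. -/
def Formula.rename (ρ : Renaming) : Formula L → Formula L
  | eq s t => eq (s.rename ρ) (t.rename ρ)
  | pred P ts => pred P (fun i => (ts i).rename ρ)
  | relEq X Y => relEq (X.rename ρ) (Y.rename ρ)
  | rel X ts => rel (X.rename ρ) (fun i => (ts i).rename ρ)
  | neg φ => neg (φ.rename ρ)
  | and φ ψ => and (φ.rename ρ) (ψ.rename ρ)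
  | or φ ψ => or (φ.rename ρ) (ψ.rename ρ)
  | imp φ ψ => imp (φ.rename ρ) (ψ.rename ρ)
  | iff φ ψ => iff (φ.rename ρ) (ψ.rename ρ)
  | all x φ => all x (φ.rename ρ)
  | ex x φ => ex x (φ.rename ρ)
  | all₂ n X φ => all₂ n X (φ.rename ρ)
  | ex₂ n X φ => ex₂ n X (φ.rename ρ)
  | lam x ψ t => lam x (ψ.rename ρ) (t.rename ρ)
  | lamIota x ψ y φ => lamIota x (ψ.rename ρ) y (φ.rename ρ)
  | lamIota₂ n X ψ Y φ => lamIota₂ n X (ψ.rename ρ) Y (φ.rename ρ)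

section Rename

variable {ρ σ : Renaming} {φ : Formula L} {a b : ℕ}

theorem Term.rename_subst (ρ : Renaming) (x b : ℕ) (t : Term L) :
    (t.subst x b).rename ρ = (t.rename ρ).subst x (ρ.par b) := by
  cases t <;> simp only [Term.subst, Term.rename]
  split_ifs <;> rfl

theorem RTerm.rename_subst (ρ : Renaming) (n : ℕ+) (X B : ℕ) {m : ℕ+} (t : RTerm L m) :
    (t.subst n X B).rename ρ = (t.rename ρ).subst n X (ρ.rpar n B) := by
  cases t <;> simp only [RTerm.subst, RTerm.rename]
  split_ifs with h
  · obtain ⟨rfl, -⟩ := h; rfl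
  · rfl

namespace Formula

theorem rename_subst (ρ : Renaming) (x b : ℕ) (φ : Formula L) :
    (φ.subst x b).rename ρ = (φ.rename ρ).subst x (ρ.par b) := by
  induction φ <;> simp only [subst, rename, Term.rename_subst, *] <;> split_ifs <;> simp only [*]

theorem rename_subst₂ (ρ : Renaming) (n : ℕ+) (X B : ℕ) (φ : Formula L) :
    (φ.subst₂ n X B).rename ρ = (φ.rename ρ).subst₂ n X (ρ.rpar n B) := by
  induction φ <;> simp only [subst₂, rename, RTerm.rename_subst, *] <;> split_ifs <;>
    simp only [*]

end Formula

theorem Term.rename_congr {t : Term L} (h : ∀ a, t = .par a → ρ.par a = σ.par a) :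
    t.rename ρ = t.rename σ := by
  cases t <;> simp_all [Term.rename]

theorem RTerm.rename_congr {n : ℕ+} {X : RTerm L n}
    (h : ∀ A, X = .par A → ρ.rpar n A = σ.rpar n A) : X.rename ρ = X.rename σ := by
  cases X <;> simp_all [RTerm.rename]

namespace Formula

theorem rename_congr (h : ∀ a, φ.HasPar a → ρ.par a = σ.par a)
    (h₂ : ∀ n A, φ.HasRPar n A → ρ.rpar n A = σ.rpar n A) : φ.rename ρ = φ.rename σ := by
  induction φ with
  | pred P ts =>
    simp only [rename]
    congr 1
    exact funext fun i => Term.rename_congr fun a ha => h a ⟨i, ha⟩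
  | rel X ts =>
    simp only [rename]
    congr 1
    · exact RTerm.rename_congr fun A hA => h₂ _ A ⟨rfl, hA⟩
    · exact funext fun i => Term.rename_congr fun a ha => h a ⟨i, ha⟩
  | _ => grind [rename, HasPar, HasRPar, Term.rename_congr, RTerm.rename_congr]

theorem rename_id : φ.rename .id = φ := by
  have hterm : ∀ t : Term L, t.rename .id = t := fun t => by cases t <;> rfl
  have hrterm : ∀ {n} (X : RTerm L n), X.rename .id = X := fun X => by cases X <;> rfl
  induction φ <;> simp only [rename, *]

theorem rename_setPar (h : ¬ φ.HasPar a) : φ.rename (ρ.setPar a b) = φ.rename ρ :=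
  rename_congr (fun _ hc => ρ.setPar_par_of_ne fun hca => h (hca ▸ hc)) fun _ _ _ => rfl

theorem rename_setPars {n : ℕ} {a b : Fin n → ℕ} (h : ∀ i, ¬ φ.HasPar (a i)) :
    φ.rename (ρ.setPars a b) = φ.rename ρ :=
  rename_congr (fun _ hc => Function.extend_apply' _ _ _ fun ⟨i, hi⟩ => h i (hi ▸ hc))
    fun _ _ _ => rfl

theorem rename_setRPar {n : ℕ+} {A B : ℕ} (h : ¬ φ.HasRPar n A) :
    φ.rename (ρ.setRPar n A B) = φ.rename ρ :=
  rename_congr (fun _ _ => rfl) fun _ _ hC => if_neg fun ⟨hn, hA⟩ => h (hn ▸ hA ▸ hC)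

end Formula

end Rename

open Formula

/-! ### Fresh parameters -/

section Fresh

variable {Γ : Multiset (Formula L)} {ρ : Renaming}

theorem map_rename_setPar {a b : ℕ} (h : Fresh a Γ) :
    Γ.map (rename (ρ.setPar a b)) = Γ.map (rename ρ) :=
  Multiset.map_congr rfl fun φ hφ => rename_setPar (h φ hφ)

theorem map_rename_setPars {n : ℕ} {a b : Fin n → ℕ} (h : ∀ i, Fresh (a i) Γ) :
    Γ.map (rename (ρ.setPars a b)) = Γ.map (rename ρ) :=
  Multiset.map_congr rfl fun φ hφ => rename_setPars fun i => h i φ hφ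

theorem map_rename_setRPar {n : ℕ+} {A B : ℕ} (h : Fresh₂ n A Γ) :
    Γ.map (rename (ρ.setRPar n A B)) = Γ.map (rename ρ) :=
  Multiset.map_congr rfl fun φ hφ => rename_setRPar (h φ hφ)

open Filter

theorem Term.eventually_ne_par (t : Term L) : ∀ᶠ a in cofinite, t ≠ .par a := by
  cases t <;> simp

theorem RTerm.eventually_ne_par {n : ℕ+} (X : RTerm L n) : ∀ᶠ A in cofinite, X ≠ .par A := by
  cases X <;> simp

theorem Formula.eventually_not_hasPar (φ : Formula L) : ∀ᶠ a in cofinite, ¬ φ.HasPar a := by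
  induction φ <;> simp only [HasPar, not_or, not_exists, not_false_eq_true, eventually_and,
    eventually_all, eventually_true, Term.eventually_ne_par, implies_true, and_self, *]

theorem Formula.eventually_not_hasRPar (n : ℕ+) (φ : Formula L) :
    ∀ᶠ A in cofinite, ¬ φ.HasRPar n A := by
  induction φ <;> simp only [HasRPar, not_or, not_and, not_false_eq_true, eventually_and,
    eventually_imp_distrib_left, eventually_true, RTerm.eventually_ne_par, implies_true,
    and_self, *]

theorem eventually_fresh (Γ : Multiset (Formula L)) : ∀ᶠ a in cofinite, Fresh a Γ :=
  (eventually_all_finite (Multiset.finite_toSet Γ)).2 fun φ _ => φ.eventually_not_hasPar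

theorem eventually_fresh₂ (n : ℕ+) (Γ : Multiset (Formula L)) :
    ∀ᶠ A in cofinite, Fresh₂ n A Γ :=
  (eventually_all_finite (Multiset.finite_toSet Γ)).2 fun φ _ => φ.eventually_not_hasRPar n

theorem exists_injective_fresh (n : ℕ) (Γ Δ : Multiset (Formula L)) :
    ∃ a : Fin n → ℕ, a.Injective ∧ (∀ i, Fresh (a i) Γ) ∧ ∀ i, Fresh (a i) Δ := by
  have hinf : {a | Fresh a Γ ∧ Fresh a Δ}.Infinite := frequently_cofinite_iff_infinite.1
    ((eventually_fresh Γ).and (eventually_fresh Δ)).frequently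
  let f := hinf.natEmbedding
  exact ⟨fun i => f i, fun i j h => Fin.ext (f.injective (Subtype.ext h)),
    fun i => (f i).2.1, fun i => (f i).2.2⟩

end Fresh

/-! ### The cumulative calculus of RLL -/

/-- The degree of a formula, on which cut elimination proceeds by induction. An identity of
relations weighs more than the atoms it reduces to; a description weighs more than the identities
in its rules. -/
def Formula.deg : Formula L → ℕ
  | eq _ _ => 0
  | pred _ _ => 0
  | relEq _ _ => 1
  | rel _ _ => 0
  | neg φ => φ.deg + 1
  | and φ ψ => φ.deg + ψ.deg + 1
  | or φ ψ => φ.deg + ψ.deg + 1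
  | imp φ ψ => φ.deg + ψ.deg + 1
  | iff φ ψ => φ.deg + ψ.deg + 1
  | all _ φ => φ.deg + 1
  | ex _ φ => φ.deg + 1
  | all₂ _ _ φ => φ.deg + 1
  | ex₂ _ _ φ => φ.deg + 1
  | lam _ ψ _ => ψ.deg + 1
  | lamIota _ ψ _ φ => ψ.deg + φ.deg + 2
  | lamIota₂ _ _ ψ _ φ => ψ.deg + φ.deg + 2

theorem Formula.deg_subst (x b : ℕ) (φ : Formula L) : (φ.subst x b).deg = φ.deg := by
  induction φ <;> simp only [subst, deg, apply_ite deg, ite_self, *]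

theorem Formula.deg_subst₂ (n : ℕ+) (X B : ℕ) (φ : Formula L) :
    (φ.subst₂ n X B).deg = φ.deg := by
  induction φ <;> simp only [subst₂, deg, apply_ite deg, ite_self, *]

theorem Formula.isAtomic_of_deg_eq_zero {φ : Formula L} (h : φ.deg = 0) : φ.IsAtomic := by
  cases φ <;> trivial

/-- The atom `X(b₁,…,bₙ)` for individual parameters `b₁,…,bₙ`. -/
abbrev atom {n : ℕ+} (X : RTerm L n) (b : Fin n → ℕ) : Formula L := rel X fun i => .par (b i)

/-- `RightRule φ I`: the succedent formula `φ` is inferred from the premises `I`, with a premise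
for every parameter in place of one for an eigenvariable. -/
inductive RightRule : Formula L → Set (Premise (Formula L)) → Prop
  | neg φ : RightRule (neg φ) {({φ}, 0)}
  | and φ ψ : RightRule (and φ ψ) {(0, {φ}), (0, {ψ})}
  | or φ ψ : RightRule (or φ ψ) {(0, {φ, ψ})}
  | imp φ ψ : RightRule (imp φ ψ) {({φ}, {ψ})}
  | iff φ ψ : RightRule (iff φ ψ) {({φ}, {ψ}), ({ψ}, {φ})}
  | all x φ : RightRule (all x φ) (Set.range fun a => (0, {φ.subst x a}))
  | ex x φ b : RightRule (ex x φ) {(0, {φ.subst x b})}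
  | all₂ n X φ : RightRule (all₂ n X φ) (Set.range fun A => (0, {φ.subst₂ n X A}))
  | ex₂ n X φ B : RightRule (ex₂ n X φ) {(0, {φ.subst₂ n X B})}
  | lam x ψ b : RightRule (lam x ψ (.par b)) {(0, {ψ.subst x b})}
  | lamIota x ψ y φ b : RightRule (lamIota x ψ y φ)
      (insert (0, {φ.subst y b}) (insert (0, {ψ.subst x b})
        (Set.range fun a => ({φ.subst y a}, {eq (.par a) (.par b)}))))
  | relEq {n : ℕ+} (X Y : RTerm L n) : RightRule (relEq X Y)
      (Set.range (fun a => ({atom X a}, {atom Y a})) ∪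
        Set.range fun a => ({atom Y a}, {atom X a}))
  | lamIota₂ n X ψ Y φ B : RightRule (lamIota₂ n X ψ Y φ)
      (insert (0, {φ.subst₂ n Y B}) (insert (0, {ψ.subst₂ n X B})
        (Set.range fun A => ({φ.subst₂ n Y A}, {relEq (n := n) (.par A) (.par B)}))))

/-- `LeftRule φ I`: the antecedent formula `φ` is inferred from the premises `I`, with a premise
for every parameter in place of one for an eigenvariable. -/
inductive LeftRule : Formula L → Set (Premise (Formula L)) → Prop
  | neg φ : LeftRule (neg φ) {(0, {φ})}
  | and φ ψ : LeftRule (and φ ψ) {({φ, ψ}, 0)}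
  | or φ ψ : LeftRule (or φ ψ) {({φ}, 0), ({ψ}, 0)}
  | imp φ ψ : LeftRule (imp φ ψ) {(0, {φ}), ({ψ}, 0)}
  | iff φ ψ : LeftRule (iff φ ψ) {(0, {φ, ψ}), ({φ, ψ}, 0)}
  | all x φ b : LeftRule (all x φ) {({φ.subst x b}, 0)}
  | ex x φ : LeftRule (ex x φ) (Set.range fun a => ({φ.subst x a}, 0))
  | all₂ n X φ B : LeftRule (all₂ n X φ) {({φ.subst₂ n X B}, 0)}
  | ex₂ n X φ : LeftRule (ex₂ n X φ) (Set.range fun A => ({φ.subst₂ n X A}, 0))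
  | lam x ψ b : LeftRule (lam x ψ (.par b)) {({ψ.subst x b}, 0)}
  | lamIota x ψ y φ : LeftRule (lamIota x ψ y φ)
      (Set.range fun a => ({φ.subst y a, ψ.subst x a}, 0))
  | lamIota_eq x ψ y φ b c : LeftRule (lamIota x ψ y φ)
      {(0, {φ.subst y b}), (0, {φ.subst y c}), ({eq (.par b) (.par c)}, 0)}
  | relEq {n : ℕ+} (X Y : RTerm L n) b : LeftRule (relEq X Y)
      {(0, {atom X b, atom Y b}), ({atom X b, atom Y b}, 0)}
  | lamIota₂ n X ψ Y φ : LeftRule (lamIota₂ n X ψ Y φ)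
      (Set.range fun A => ({φ.subst₂ n Y A, ψ.subst₂ n X A}, 0))
  | lamIota₂_eq n X ψ Y φ B C : LeftRule (lamIota₂ n X ψ Y φ)
      {(0, {φ.subst₂ n Y B}), (0, {φ.subst₂ n Y C}), ({relEq (n := n) (.par B) (.par C)}, 0)}

/-- The rules for the identity of individuals. Replacement is confined to formulas of degree `0`,
the atoms other than `X = Y`: in `X = Y` no individual variable occurs. -/
inductive AnteRule : Multiset (Formula L) → Formula L → Prop
  | refl b : AnteRule 0 (eq (.par b) (.par b))
  | replace x b c (φ : Formula L) : φ.deg = 0 →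
      AnteRule {eq (.par b) (.par c), φ.subst x b} (φ.subst x c)

theorem RightRule.deg_pos {φ : Formula L} {I : Set (Premise (Formula L))} (h : RightRule φ I) :
    0 < φ.deg := by
  cases h <;> simp only [deg] <;> positivity

theorem AnteRule.deg_eq_zero {A : Multiset (Formula L)} {χ φ : Formula L} (h : AnteRule A χ)
    (hφ : φ ∈ A) : φ.deg = 0 := by
  cases h with
  | refl => simp at hφ
  | replace x b c ψ hψ =>
    obtain rfl | rfl : φ = _ ∨ φ = _ := by simpa using hφ
    · rfl
    · rwa [deg_subst]

/-- RLL without Cut, as a cumulative calculus without eigenvariables. -/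
def cumulative : CumulativeCalculus (Formula L) where
  right := RightRule
  left := LeftRule
  ante := AnteRule
  not_right_of_ante hA hφ hI := hI.deg_pos.ne' (hA.deg_eq_zero hφ)

open CumulativeCalculus

section Cumulative

variable {Γ Δ : Multiset (Formula L)} {φ : Formula L}

theorem derives_of_replace {x b c : ℕ} (hφ : φ.deg = 0) (hbc : eq (.par b) (.par c) ∈ Γ)
    (hb : φ.subst x b ∈ Γ) (h : cumulative.Derives (φ.subst x c ::ₘ Γ) Δ) :
    cumulative.Derives Γ Δ :=
  .ante (.replace x b c φ hφ) (by simp [Multiset.insert_eq_cons, Multiset.cons_subset, *]) h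

theorem derives_eq_of_eq_eq (b c d : ℕ) :
    cumulative.Derives (eq (.par b) (.par d) ::ₘ eq (.par c) (.par d) ::ₘ Γ)
      (eq (.par b) (.par c) ::ₘ Δ) := by
  refine .ante (.refl c) (Multiset.zero_subset _) ?_
  have hdc : cumulative.Derives (eq (.par d) (.par c) ::ₘ eq (.par c) (.par c) ::ₘ
      eq (.par b) (.par d) ::ₘ eq (.par c) (.par d) ::ₘ Γ) (eq (.par b) (.par c) ::ₘ Δ) := by
    refine derives_of_replace (x := 0) (b := d) (c := c) (φ := eq (.par b) (.var 0)) rfl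
      (by simp) (by simp [subst, Term.subst]) ?_
    exact .ax (φ := eq (.par b) (.par c)) (by simp [subst, Term.subst]) (by simp)
  exact derives_of_replace (x := 0) (b := c) (c := d) (φ := eq (.var 0) (.par c)) rfl
    (by simp) (by simp [subst, Term.subst]) hdc

theorem derives_of_relEq_relEq {n : ℕ+} {X Y Z : RTerm L n} {a : Fin n → ℕ}
    (hXZ : relEq X Z ∈ Γ) (hYZ : relEq Y Z ∈ Γ) (hX : atom X a ∈ Γ) (hY : atom Y a ∈ Δ) :
    cumulative.Derives Γ Δ := by
  refine .left (.relEq X Z a) hXZ (Set.forall_mem_insert.2 ⟨?_, ?_⟩)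
  · exact .ax (φ := atom X a) (by simpa) (by simp)
  · rintro _ rfl
    refine .left (.relEq Y Z a) (by simp [hYZ]) (Set.forall_mem_insert.2 ⟨?_, ?_⟩)
    · exact .ax (φ := atom Z a) (by simp) (by simp)
    · rintro _ rfl
      exact .ax (φ := atom Y a) (by simp) (by simpa)

theorem derives_relEq_of_relEq_relEq {n : ℕ+} (X Y Z : RTerm L n) :
    cumulative.Derives (relEq X Z ::ₘ relEq Y Z ::ₘ Γ) (relEq X Y ::ₘ Δ) := by
  refine .right_cons (.relEq X Y) ?_
  rintro p (⟨a, rfl⟩ | ⟨a, rfl⟩)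
  · apply derives_of_relEq_relEq (X := X) (Y := Y) (Z := Z) (a := a) <;> simp
  · apply derives_of_relEq_relEq (X := Y) (Y := X) (Z := Z) (a := a) <;> simp

theorem reducible (φ : Formula L)
    (ih : ∀ χ : Formula L, χ.deg < φ.deg → cumulative.CutAdmissible χ) :
    cumulative.Reducible φ := by
  intro Γ Δ I J hI hJ h₁ h₂
  have hsubst (x b) {ψ : Formula L} (hψ : ψ.deg < φ.deg) :
      cumulative.CutAdmissible (ψ.subst x b) := ih _ (by rwa [deg_subst])
  have hsubst₂ (n X B) {ψ : Formula L} (hψ : ψ.deg < φ.deg) :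
      cumulative.CutAdmissible (ψ.subst₂ n X B) := ih _ (by rwa [deg_subst₂])
  cases hI <;> cases hJ <;>
    simp only [Set.mem_union, Set.mem_insert_iff, Set.mem_singleton_iff, or_imp, forall_and,
      forall_eq, Set.forall_mem_range, Multiset.insert_eq_cons, Multiset.cons_add,
      Multiset.singleton_add, zero_add] at h₁ h₂
  case neg.neg φ => exact (ih φ (by grind [deg])).cut h₂ h₁
  case and.and φ ψ => exact (ih φ (by grind [deg])).cut_conj (ih ψ (by grind [deg])) h₁.1 h₁.2 h₂
  case or.or φ ψ => exact (ih φ (by grind [deg])).cut_disj (ih ψ (by grind [deg])) h₁ h₂.1 h₂.2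
  case imp.imp φ ψ =>
    exact (ih φ (by grind [deg])).cut_imp (ih ψ (by grind [deg])) h₁ h₂.1 h₂.2
  case iff.iff φ ψ =>
    exact (ih φ (by grind [deg])).cut_iff (ih ψ (by grind [deg])) h₁.1 h₁.2 h₂.1 h₂.2
  case all.all x φ b => exact hsubst x b (by grind [deg]) (h₁ b) h₂
  case ex.ex x φ b => exact hsubst x b (by grind [deg]) h₁ (h₂ b)
  case all₂.all₂ n X φ B => exact hsubst₂ n X B (by grind [deg]) (h₁ B) h₂
  case ex₂.ex₂ n X φ B => exact hsubst₂ n X B (by grind [deg]) h₁ (h₂ B)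
  case lam.lam x ψ b => exact hsubst x b (by grind [deg]) h₁ h₂
  case lamIota.lamIota x ψ y φ b =>
    exact (hsubst y b (by grind [deg])).cut_conj (hsubst x b (by grind [deg])) h₁.1 h₁.2.1 (h₂ b)
  case lamIota.lamIota_eq x ψ y φ b c d =>
    exact (hsubst y c (by grind [deg])).cut_unique (hsubst y d (by grind [deg]))
      (ih _ (by grind [deg])) (ih _ (by grind [deg])) (ih _ (by grind [deg]))
      (h₁.2.2 c) (h₁.2.2 d) h₂.1 h₂.2.1 h₂.2.2 (derives_eq_of_eq_eq c d b)
  case relEq.relEq X Y b =>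
    exact (ih (atom X b) (by grind [deg])).cut_iff (ih (atom Y b) (by grind [deg]))
      (h₁.1 b) (h₁.2 b) h₂.1 h₂.2
  case lamIota₂.lamIota₂ n X ψ Y φ B =>
    exact (hsubst₂ n Y B (by grind [deg])).cut_conj (hsubst₂ n X B (by grind [deg]))
      h₁.1 h₁.2.1 (h₂ B)
  case lamIota₂.lamIota₂_eq n X ψ Y φ B C D =>
    exact (hsubst₂ n Y C (by grind [deg])).cut_unique (hsubst₂ n Y D (by grind [deg]))
      (ih _ (by grind [deg])) (ih _ (by grind [deg])) (ih _ (by grind [deg]))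
      (h₁.2.2 C) (h₁.2.2 D) h₂.1 h₂.2.1 h₂.2.2 (derives_relEq_of_relEq_relEq _ _ _)

theorem cutAdmissible (φ : Formula L) : cumulative.CutAdmissible φ :=
  cutAdmissible_of_reducible deg reducible φ

end Cumulative

/-! ### From RLL to the cumulative calculus -/

/-- All instances of the sequent under renamings of parameters are derivable in the cumulative
calculus. -/
def Sequent.StablyDerivable (S : Sequent L) : Prop :=
  ∀ ρ : Renaming, cumulative.Derives (S.ante.map (rename ρ)) (S.succ.map (rename ρ))

theorem Formula.deg_rename (ρ : Renaming) (φ : Formula L) : (φ.rename ρ).deg = φ.deg := by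
  induction φ <;> simp only [rename, deg, *]

namespace Sequent.StablyDerivable

variable {Γ Δ : Multiset (Formula L)} {φ ψ : Formula L}

theorem cut {Γ' Δ' : Multiset (Formula L)} (h₁ : (Γ ⟹ φ ::ₘ Δ).StablyDerivable)
    (h₂ : (φ ::ₘ Γ' ⟹ Δ').StablyDerivable) : (Γ + Γ' ⟹ Δ + Δ').StablyDerivable := by
  intro ρ
  refine (cutAdmissible (φ.rename ρ)).cut (h₁ ρ) (h₂ ρ) ?_ ?_ ?_ ?_ <;>
    grind [Multiset.subset_iff, Multiset.map_cons, Multiset.map_add]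

theorem eqMinus {x b c : ℕ} (hφ : φ.IsAtomic) (h : (φ.subst x c ::ₘ Γ ⟹ Δ).StablyDerivable) :
    (eq (.par b) (.par c) ::ₘ φ.subst x b ::ₘ Γ ⟹ Δ).StablyDerivable := by
  intro ρ
  have hc := h ρ
  simp only [Multiset.map_cons, rename_subst] at hc ⊢
  have hreplace (hdeg : φ.deg = 0) : cumulative.Derives
      ((eq (.par b) (.par c)).rename ρ ::ₘ (φ.rename ρ).subst x (ρ.par b) ::ₘ Γ.map (rename ρ))
      (Δ.map (rename ρ)) :=
    derives_of_replace (φ := φ.rename ρ) (x := x) (b := ρ.par b) (c := ρ.par c)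
      (by rwa [deg_rename]) (by simp [rename, Term.rename]) (by simp) hc.weaken
  cases φ with
  | relEq X Y => exact hc.weaken (Multiset.subset_cons _ _)
  | eq | pred | rel => exact hreplace rfl
  | _ => exact hφ.elim

section Individual

variable {a b x y : ℕ} (hΓ : Fresh a Γ) (hΔ : Fresh a Δ) (hφ : ¬ φ.HasPar a)
include hΓ hΔ hφ

theorem allR (h : (Γ ⟹ φ.subst x a ::ₘ Δ).StablyDerivable) :
    (Γ ⟹ all x φ ::ₘ Δ).StablyDerivable := by
  intro ρ
  rw [Multiset.map_cons]
  refine .right_cons (.all x _) (Set.forall_mem_range.2 fun d => ?_)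
  simpa [rename_subst, rename_setPar hφ, map_rename_setPar hΓ, map_rename_setPar hΔ,
    Renaming.setPar_par_self] using h (ρ.setPar a d)

theorem exL (h : (φ.subst x a ::ₘ Γ ⟹ Δ).StablyDerivable) :
    (ex x φ ::ₘ Γ ⟹ Δ).StablyDerivable := by
  intro ρ
  rw [Multiset.map_cons]
  refine .left_cons (.ex x _) (Set.forall_mem_range.2 fun d => ?_)
  simpa [rename_subst, rename_setPar hφ, map_rename_setPar hΓ, map_rename_setPar hΔ,
    Renaming.setPar_par_self] using h (ρ.setPar a d)

theorem iotaL₁ (hψ : ¬ ψ.HasPar a)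
    (h : (φ.subst y a ::ₘ ψ.subst x a ::ₘ Γ ⟹ Δ).StablyDerivable) :
    (lamIota x ψ y φ ::ₘ Γ ⟹ Δ).StablyDerivable := by
  intro ρ
  rw [Multiset.map_cons]
  refine .left_cons (.lamIota x _ y _) (Set.forall_mem_range.2 fun d => ?_)
  simpa [rename_subst, rename_setPar hφ, rename_setPar hψ, map_rename_setPar hΓ,
    map_rename_setPar hΔ, Renaming.setPar_par_self] using h (ρ.setPar a d)

theorem iotaR (hab : a ≠ b) (hb : (Γ ⟹ φ.subst y b ::ₘ Δ).StablyDerivable)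
    (hψ : (Γ ⟹ ψ.subst x b ::ₘ Δ).StablyDerivable)
    (h : (φ.subst y a ::ₘ Γ ⟹ eq (.par a) (.par b) ::ₘ Δ).StablyDerivable) :
    (Γ ⟹ lamIota x ψ y φ ::ₘ Δ).StablyDerivable := by
  intro ρ
  rw [Multiset.map_cons]
  refine .right_cons (.lamIota x _ y _ (ρ.par b)) ?_
  simp only [Set.forall_mem_insert, Set.forall_mem_range]
  refine ⟨by simpa [rename_subst] using hb ρ, by simpa [rename_subst] using hψ ρ, fun d => ?_⟩
  simpa [rename_subst, rename_setPar hφ, map_rename_setPar hΓ, map_rename_setPar hΔ, rename,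
    Term.rename, Renaming.setPar_par_self,
    ρ.setPar_par_of_ne hab.symm] using h (ρ.setPar a d)

end Individual

section Relational

variable {n : ℕ+} {A B X Y : ℕ} (hΓ : Fresh₂ n A Γ) (hΔ : Fresh₂ n A Δ) (hφ : ¬ φ.HasRPar n A)
include hΓ hΔ hφ

theorem allR₂ (h : (Γ ⟹ φ.subst₂ n X A ::ₘ Δ).StablyDerivable) :
    (Γ ⟹ all₂ n X φ ::ₘ Δ).StablyDerivable := by
  intro ρ
  rw [Multiset.map_cons]
  refine .right_cons (.all₂ n X _) (Set.forall_mem_range.2 fun D => ?_)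
  simpa [rename_subst₂, rename_setRPar hφ, map_rename_setRPar hΓ, map_rename_setRPar hΔ,
    Renaming.setRPar_rpar_self] using h (ρ.setRPar n A D)

theorem exL₂ (h : (φ.subst₂ n X A ::ₘ Γ ⟹ Δ).StablyDerivable) :
    (ex₂ n X φ ::ₘ Γ ⟹ Δ).StablyDerivable := by
  intro ρ
  rw [Multiset.map_cons]
  refine .left_cons (.ex₂ n X _) (Set.forall_mem_range.2 fun D => ?_)
  simpa [rename_subst₂, rename_setRPar hφ, map_rename_setRPar hΓ, map_rename_setRPar hΔ,
    Renaming.setRPar_rpar_self] using h (ρ.setRPar n A D)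

theorem iotaL₁₂ (hψ : ¬ ψ.HasRPar n A)
    (h : (φ.subst₂ n Y A ::ₘ ψ.subst₂ n X A ::ₘ Γ ⟹ Δ).StablyDerivable) :
    (lamIota₂ n X ψ Y φ ::ₘ Γ ⟹ Δ).StablyDerivable := by
  intro ρ
  rw [Multiset.map_cons]
  refine .left_cons (.lamIota₂ n X _ Y _) (Set.forall_mem_range.2 fun D => ?_)
  simpa [rename_subst₂, rename_setRPar hφ, rename_setRPar hψ, map_rename_setRPar hΓ,
    map_rename_setRPar hΔ, Renaming.setRPar_rpar_self] using h (ρ.setRPar n A D)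

theorem iotaR₂ (hAB : A ≠ B) (hB : (Γ ⟹ φ.subst₂ n Y B ::ₘ Δ).StablyDerivable)
    (hψ : (Γ ⟹ ψ.subst₂ n X B ::ₘ Δ).StablyDerivable)
    (h : (φ.subst₂ n Y A ::ₘ Γ ⟹
      relEq (n := n) (.par A) (.par B) ::ₘ Δ).StablyDerivable) :
    (Γ ⟹ lamIota₂ n X ψ Y φ ::ₘ Δ).StablyDerivable := by
  intro ρ
  rw [Multiset.map_cons]
  refine .right_cons (.lamIota₂ n X _ Y _ (ρ.rpar n B)) ?_
  simp only [Set.forall_mem_insert, Set.forall_mem_range]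
  refine ⟨by simpa [rename_subst₂] using hB ρ, by simpa [rename_subst₂] using hψ ρ, fun D => ?_⟩
  simpa [rename_subst₂, rename_setRPar hφ, map_rename_setRPar hΓ, map_rename_setRPar hΔ, rename,
    RTerm.rename, Renaming.setRPar_rpar_self,
    ρ.setRPar_rpar_of_ne hAB.symm] using h (ρ.setRPar n A D)

end Relational

theorem relEqR {n : ℕ+} {X Y : RTerm L n} {a : Fin n → ℕ} (ha : a.Injective)
    (hΓ : ∀ i, Fresh (a i) Γ) (hΔ : ∀ i, Fresh (a i) Δ)
    (hXY : (atom X a ::ₘ Γ ⟹ atom Y a ::ₘ Δ).StablyDerivable)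
    (hYX : (atom Y a ::ₘ Γ ⟹ atom X a ::ₘ Δ).StablyDerivable) :
    (Γ ⟹ relEq X Y ::ₘ Δ).StablyDerivable := by
  have hrename (ρ : Renaming) (d : Fin n → ℕ) (Z : RTerm L n) :
      (atom Z a).rename (ρ.setPars a d) = atom (Z.rename ρ) d := by
    simp only [rename, Term.rename, Renaming.setPars_par_apply ρ ha]
    rfl
  intro ρ
  rw [Multiset.map_cons]
  refine .right_cons (.relEq _ _) ?_
  rintro p (⟨d, rfl⟩ | ⟨d, rfl⟩)
  · simpa [hrename, map_rename_setPars hΓ, map_rename_setPars hΔ] using hXY (ρ.setPars a d)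
  · simpa [hrename, map_rename_setPars hΓ, map_rename_setPars hΔ] using hYX (ρ.setPars a d)

end Sequent.StablyDerivable

theorem Rule.stablyDerivable {ps : List (Sequent L)} {S : Sequent L} (hS : Rule ps S)
    (h : ∀ P ∈ ps, P.StablyDerivable) : S.StablyDerivable := by
  cases hS <;> simp only [List.mem_cons, List.not_mem_nil, or_false, or_imp, forall_and,
    forall_eq] at h
  case allR hΓ hΔ hφ => exact .allR hΓ hΔ hφ h
  case exL hΓ hΔ hφ => exact .exL hΓ hΔ hφ h
  case eqMinus hφ => exact .eqMinus hφ h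
  case iotaL₁ hΓ hΔ hφ hψ => exact .iotaL₁ hΓ hΔ hφ hψ h
  case iotaR hΓ hΔ hφ hab => exact .iotaR hΓ hΔ hφ hab h.1 h.2.1 h.2.2
  case relEqR ha hΓ hΔ => exact .relEqR ha hΓ hΔ h.1 h.2
  case allR₂ hΓ hΔ hφ => exact .allR₂ hΓ hΔ hφ h
  case exL₂ hΓ hΔ hφ => exact .exL₂ hΓ hΔ hφ h
  case iotaL₁₂ hΓ hΔ hφ hψ => exact .iotaL₁₂ hΓ hΔ hφ hψ h
  case iotaR₂ hΓ hΔ hφ hAB => exact .iotaR₂ hΓ hΔ hφ hAB h.1 h.2.1 h.2.2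
  all_goals
    intro ρ
    simp only [Sequent.StablyDerivable, Multiset.map_cons, Multiset.map_singleton,
      rename_subst, rename_subst₂, rename, Term.rename, RTerm.rename] at h ⊢
  case ax φ => exact .ax (Multiset.mem_singleton_self _) (Multiset.mem_singleton_self _)
  case weakL | weakR | contrL | contrR => exact (h ρ).weaken
  case andL => exact .left_cons (.and _ _) (by simpa using h ρ)
  case andR => exact .right_cons (.and _ _) (by simpa using ⟨h.1 ρ, h.2 ρ⟩)
  case negL => exact .left_cons (.neg _) (by simpa using h ρ)
  case negR => exact .right_cons (.neg _) (by simpa using h ρ)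
  case orL => exact .left_cons (.or _ _) (by simpa using ⟨h.1 ρ, h.2 ρ⟩)
  case orR => exact .right_cons (.or _ _) (by simpa using h ρ)
  case impL => exact .left_cons (.imp _ _) (by simpa using ⟨h.1 ρ, h.2 ρ⟩)
  case impR => exact .right_cons (.imp _ _) (by simpa using h ρ)
  case iffL => exact .left_cons (.iff _ _) (by simpa using ⟨h.1 ρ, h.2 ρ⟩)
  case iffR => exact .right_cons (.iff _ _) (by simpa using ⟨h.1 ρ, h.2 ρ⟩)
  case allL b => exact .left_cons (.all _ _ (ρ.par b)) (by simpa using h ρ)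
  case exR b => exact .right_cons (.ex _ _ (ρ.par b)) (by simpa using h ρ)
  case eqPlus b => exact .ante (.refl (ρ.par b)) (Multiset.zero_subset _) (h ρ)
  case lamL b => exact .left_cons (.lam _ _ (ρ.par b)) (by simpa using h ρ)
  case lamR b => exact .right_cons (.lam _ _ (ρ.par b)) (by simpa using h ρ)
  case iotaL₂ b c =>
    exact .left_cons (.lamIota_eq _ _ _ _ (ρ.par b) (ρ.par c))
      (by simpa using ⟨h.1 ρ, h.2.1 ρ, h.2.2 ρ⟩)
  case relEqL b =>
    exact .left_cons (.relEq _ _ (ρ.par ∘ b)) (by simpa using ⟨h.1 ρ, h.2 ρ⟩)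
  case allL₂ n _ _ B => exact .left_cons (.all₂ n _ _ (ρ.rpar n B)) (by simpa using h ρ)
  case exR₂ n _ _ B => exact .right_cons (.ex₂ n _ _ (ρ.rpar n B)) (by simpa using h ρ)
  case iotaL₂₂ n _ _ _ _ B C =>
    exact .left_cons (.lamIota₂_eq n _ _ _ _ (ρ.rpar n B) (ρ.rpar n C))
      (by simpa using ⟨h.1 ρ, h.2.1 ρ, h.2.2 ρ⟩)

theorem Provable.stablyDerivable {S : Sequent L} (h : Provable S) : S.StablyDerivable := by
  induction h with
  | node ps S hS _ ih =>
    rcases hS with hrule | ⟨Γ, Δ, Γ', Δ', φ⟩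
    · exact hrule.stablyDerivable ih
    · exact .cut (ih (Γ ⟹ φ ::ₘ Δ) (by simp)) (ih (φ ::ₘ Γ' ⟹ Δ') (by simp))

/-! ### From the cumulative calculus to cut-free RLL -/

namespace CutFreeProvable

open Filter

variable {Γ Δ : Multiset (Formula L)} {φ : Formula L}

theorem of_rule₁ {P S : Sequent L} (h : Rule [P] S) (hP : CutFreeProvable P) :
    CutFreeProvable S :=
  .node _ _ h (List.forall_mem_singleton.2 hP)

theorem of_rule₂ {P Q S : Sequent L} (h : Rule [P, Q] S) (hP : CutFreeProvable P)
    (hQ : CutFreeProvable Q) : CutFreeProvable S :=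
  .node _ _ h (List.forall_mem_cons.2 ⟨hP, List.forall_mem_singleton.2 hQ⟩)

theorem of_rule₃ {P Q R S : Sequent L} (h : Rule [P, Q, R] S) (hP : CutFreeProvable P)
    (hQ : CutFreeProvable Q) (hR : CutFreeProvable R) : CutFreeProvable S :=
  .node _ _ h (List.forall_mem_cons.2 ⟨hP, List.forall_mem_cons.2 ⟨hQ,
    List.forall_mem_singleton.2 hR⟩⟩)

theorem weakL (Γ' : Multiset (Formula L)) (h : CutFreeProvable (Γ ⟹ Δ)) :
    CutFreeProvable (Γ' + Γ ⟹ Δ) := by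
  induction Γ' using Multiset.induction with
  | empty => rwa [zero_add]
  | cons φ Γ' ih => rw [Multiset.cons_add]; exact of_rule₁ (.weakL _ _ _) ih

theorem weakR (Δ' : Multiset (Formula L)) (h : CutFreeProvable (Γ ⟹ Δ)) :
    CutFreeProvable (Γ ⟹ Δ' + Δ) := by
  induction Δ' using Multiset.induction with
  | empty => rwa [zero_add]
  | cons φ Δ' ih => rw [Multiset.cons_add]; exact of_rule₁ (.weakR _ _ _) ih

theorem contrL (hφ : φ ∈ Γ) (h : CutFreeProvable (φ ::ₘ Γ ⟹ Δ)) : CutFreeProvable (Γ ⟹ Δ) := by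
  obtain ⟨Γ, rfl⟩ := Multiset.exists_cons_of_mem hφ
  exact of_rule₁ (.contrL _ _ _) h

theorem contrR (hφ : φ ∈ Δ) (h : CutFreeProvable (Γ ⟹ φ ::ₘ Δ)) : CutFreeProvable (Γ ⟹ Δ) := by
  obtain ⟨Δ, rfl⟩ := Multiset.exists_cons_of_mem hφ
  exact of_rule₁ (.contrR _ _ _) h

theorem of_mem_of_mem (hΓ : φ ∈ Γ) (hΔ : φ ∈ Δ) : CutFreeProvable (Γ ⟹ Δ) := by
  obtain ⟨Γ, rfl⟩ := Multiset.exists_cons_of_mem hΓ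
  obtain ⟨Δ, rfl⟩ := Multiset.exists_cons_of_mem hΔ
  have hφ : CutFreeProvable ({φ} ⟹ {φ}) := .node _ _ (.ax φ) (List.forall_mem_nil _)
  simpa only [add_comm _ {φ}, Multiset.singleton_add] using (hφ.weakL Γ).weakR Δ

theorem of_rightRule {I : Set (Premise (Formula L))} (hI : RightRule φ I)
    (h : ∀ p ∈ I, CutFreeProvable (p.1 + Γ ⟹ p.2 + Δ)) : CutFreeProvable (Γ ⟹ φ ::ₘ Δ) := by
  have hfresh := (eventually_fresh Γ).and (eventually_fresh Δ)
  have hfresh₂ (n) := (eventually_fresh₂ n Γ).and (eventually_fresh₂ n Δ)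
  cases hI <;>
    simp only [Set.mem_union, Set.mem_insert_iff, Set.mem_singleton_iff, or_imp, forall_and,
      forall_eq, Set.forall_mem_range, Multiset.insert_eq_cons, Multiset.cons_add,
      Multiset.singleton_add, zero_add] at h
  case neg => exact of_rule₁ (.negR _ _ _) h
  case and => exact of_rule₂ (.andR _ _ _ _) h.1 h.2
  case or => exact of_rule₁ (.orR _ _ _ _) h
  case imp => exact of_rule₁ (.impR _ _ _ _) h
  case iff => exact of_rule₂ (.iffR _ _ _ _) h.1 h.2
  case all x φ =>
    obtain ⟨a, ⟨hΓ, hΔ⟩, hφ⟩ := (hfresh.and φ.eventually_not_hasPar).exists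
    exact of_rule₁ (.allR _ _ _ _ a hΓ hΔ hφ) (h a)
  case ex => exact of_rule₁ (.exR _ _ _ _ _) h
  case all₂ n X φ =>
    obtain ⟨A, ⟨hΓ, hΔ⟩, hφ⟩ := ((hfresh₂ n).and (φ.eventually_not_hasRPar n)).exists
    exact of_rule₁ (.allR₂ _ _ _ _ _ A hΓ hΔ hφ) (h A)
  case ex₂ => exact of_rule₁ (.exR₂ _ _ _ _ _ _) h
  case lam => exact of_rule₁ (.lamR _ _ _ _ _) h
  case lamIota x ψ y φ b =>
    obtain ⟨a, ⟨hΓ, hΔ⟩, hφ, hab⟩ :=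
      (hfresh.and (φ.eventually_not_hasPar.and (eventually_cofinite_ne b))).exists
    exact of_rule₃ (.iotaR _ _ _ _ _ _ b a hΓ hΔ hφ hab) h.1 h.2.1 (h.2.2 a)
  case relEq n X Y =>
    obtain ⟨a, ha, hΓ, hΔ⟩ := exists_injective_fresh n Γ Δ
    exact of_rule₂ (.relEqR _ _ n X Y a ha hΓ hΔ) (h.1 a) (h.2 a)
  case lamIota₂ n X ψ Y φ B =>
    obtain ⟨A, ⟨hΓ, hΔ⟩, hφ, hAB⟩ := ((hfresh₂ n).and
      ((φ.eventually_not_hasRPar n).and (eventually_cofinite_ne B))).exists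
    exact of_rule₃ (.iotaR₂ _ _ _ _ _ _ _ B A hΓ hΔ hφ hAB) h.1 h.2.1 (h.2.2 A)

theorem of_leftRule {I : Set (Premise (Formula L))} (hI : LeftRule φ I)
    (h : ∀ p ∈ I, CutFreeProvable (p.1 + Γ ⟹ p.2 + Δ)) : CutFreeProvable (φ ::ₘ Γ ⟹ Δ) := by
  have hfresh := (eventually_fresh Γ).and (eventually_fresh Δ)
  have hfresh₂ (n) := (eventually_fresh₂ n Γ).and (eventually_fresh₂ n Δ)
  cases hI <;>
    simp only [Set.mem_insert_iff, Set.mem_singleton_iff, or_imp, forall_and, forall_eq,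
      Set.forall_mem_range, Multiset.insert_eq_cons, Multiset.cons_add, Multiset.singleton_add,
      zero_add] at h
  case neg => exact of_rule₁ (.negL _ _ _) h
  case and => exact of_rule₁ (.andL _ _ _ _) h
  case or => exact of_rule₂ (.orL _ _ _ _) h.1 h.2
  case imp => exact of_rule₂ (.impL _ _ _ _) h.1 h.2
  case iff => exact of_rule₂ (.iffL _ _ _ _) h.1 h.2
  case all => exact of_rule₁ (.allL _ _ _ _ _) h
  case ex x φ =>
    obtain ⟨a, ⟨hΓ, hΔ⟩, hφ⟩ := (hfresh.and φ.eventually_not_hasPar).exists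
    exact of_rule₁ (.exL _ _ _ _ a hΓ hΔ hφ) (h a)
  case all₂ => exact of_rule₁ (.allL₂ _ _ _ _ _ _) h
  case ex₂ n X φ =>
    obtain ⟨A, ⟨hΓ, hΔ⟩, hφ⟩ := ((hfresh₂ n).and (φ.eventually_not_hasRPar n)).exists
    exact of_rule₁ (.exL₂ _ _ _ _ _ A hΓ hΔ hφ) (h A)
  case lam => exact of_rule₁ (.lamL _ _ _ _ _) h
  case lamIota x ψ y φ =>
    obtain ⟨a, ⟨hΓ, hΔ⟩, hφ, hψ⟩ :=
      (hfresh.and (φ.eventually_not_hasPar.and ψ.eventually_not_hasPar)).exists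
    exact of_rule₁ (.iotaL₁ _ _ _ _ _ _ a hΓ hΔ hφ hψ) (h a)
  case lamIota_eq => exact of_rule₃ (.iotaL₂ _ _ _ _ _ _ _ _) h.1 h.2.1 h.2.2
  case relEq => exact of_rule₂ (.relEqL _ _ _ _ _ _) h.1 h.2
  case lamIota₂ n X ψ Y φ =>
    obtain ⟨A, ⟨hΓ, hΔ⟩, hφ, hψ⟩ := ((hfresh₂ n).and
      ((φ.eventually_not_hasRPar n).and (ψ.eventually_not_hasRPar n))).exists
    exact of_rule₁ (.iotaL₁₂ _ _ _ _ _ _ _ A hΓ hΔ hφ hψ) (h A)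
  case lamIota₂_eq => exact of_rule₃ (.iotaL₂₂ _ _ _ _ _ _ _ _ _) h.1 h.2.1 h.2.2

theorem of_anteRule {A : Multiset (Formula L)} (hA : AnteRule A φ) (hAΓ : A ⊆ Γ)
    (h : CutFreeProvable (φ ::ₘ Γ ⟹ Δ)) : CutFreeProvable (Γ ⟹ Δ) := by
  cases hA with
  | refl b => exact of_rule₁ (.eqPlus _ _ b) h
  | replace x b c φ hφ =>
    have hbc : eq (.par b) (.par c) ∈ Γ := hAΓ (by simp)
    have hb : φ.subst x b ∈ Γ := hAΓ (by simp)
    exact contrL hb (contrL (Multiset.mem_cons_of_mem hbc)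
      (of_rule₁ (.eqMinus _ _ x b c φ (isAtomic_of_deg_eq_zero hφ)) h))

end CutFreeProvable

theorem CumulativeCalculus.Derives.cutFreeProvable {Γ Δ : Multiset (Formula L)}
    (h : cumulative.Derives Γ Δ) : CutFreeProvable (Γ ⟹ Δ) := by
  induction h with
  | ax hΓ hΔ => exact .of_mem_of_mem hΓ hΔ
  | right hI hφ _ ih => exact .contrR hφ (.of_rightRule hI ih)
  | left hI hφ _ ih => exact .contrL hφ (.of_leftRule hI ih)
  | ante hA hAΓ _ ih => exact .of_anteRule hA hAΓ ih

theorem Provable.cutFreeProvable {S : Sequent L} (h : Provable S) : CutFreeProvable S := by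
  have hid : Formula.rename (L := L) .id = id := funext fun _ => rename_id
  simpa only [hid, Multiset.map_id] using (h.stablyDerivable .id).cutFreeProvable

/-! ### Sequents without free variables -/

theorem Term.subst_eq_var {x b y : ℕ} {t : Term L} :
    t.subst x b = .var y ↔ y ≠ x ∧ t = .var y := by
  cases t <;> simp only [Term.subst] <;> grind

theorem RTerm.subst_eq_var {n m : ℕ+} {X B Y : ℕ} {t : RTerm L m} :
    t.subst n X B = .var Y ↔ ¬(m = n ∧ Y = X) ∧ t = .var Y := by
  cases t <;> simp only [RTerm.subst] <;> grind

namespace Formula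

variable {φ : Formula L} {n : ℕ+} {x b X B : ℕ}

theorem freeVar_subst {y : ℕ} : (φ.subst x b).FreeVar y ↔ y ≠ x ∧ φ.FreeVar y := by
  induction φ <;> simp only [subst, FreeVar, Term.subst_eq_var] <;> grind

theorem freeRVar_subst : (φ.subst x b).FreeRVar n X ↔ φ.FreeRVar n X := by
  induction φ <;> simp only [subst, FreeRVar] <;> grind

theorem freeVar_subst₂ : (φ.subst₂ n X B).FreeVar x ↔ φ.FreeVar x := by
  induction φ <;> simp only [subst₂, FreeVar] <;> grind

theorem freeRVar_subst₂ {m : ℕ+} {Y : ℕ} :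
    (φ.subst₂ n X B).FreeRVar m Y ↔ ¬(m = n ∧ Y = X) ∧ φ.FreeRVar m Y := by
  induction φ <;> simp only [subst₂, FreeRVar, RTerm.subst_eq_var] <;> grind

theorem varsBound_subst : (φ.subst x b).VarsBound ↔
    (∀ y, y ≠ x → ¬ φ.FreeVar y) ∧ ∀ n X, ¬ φ.FreeRVar n X := by
  simp only [VarsBound, freeVar_subst, freeRVar_subst, not_and]

theorem varsBound_subst₂ : (φ.subst₂ n X B).VarsBound ↔
    (∀ y, ¬ φ.FreeVar y) ∧ ∀ m Y, ¬(m = n ∧ Y = X) → ¬ φ.FreeRVar m Y := by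
  simp only [VarsBound, freeVar_subst₂, freeRVar_subst₂, not_and]

end Formula

theorem Rule.varsBound {ps : List (Sequent L)} {S : Sequent L} (h : Rule ps S)
    (hS : S.VarsBound) : ∀ P ∈ ps, P.VarsBound := by
  cases h <;> simp only [Sequent.VarsBound, List.mem_cons, List.not_mem_nil, or_false, or_imp,
    forall_and, forall_eq, Multiset.mem_cons, varsBound_subst, varsBound_subst₂] at hS ⊢ <;>
    simp only [Formula.VarsBound, FreeVar, FreeRVar] at hS ⊢ <;> grind

theorem ProvableBound.provable {S : Sequent L} (h : ProvableBound S) : Provable S := by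
  induction h with
  | node ps S hS _ ih => exact .node ps S hS.1 ih

theorem ProvableBound.varsBound {S : Sequent L} (h : ProvableBound S) : S.VarsBound := by
  cases h with
  | node _ _ hS _ => exact hS.2

theorem CutFreeProvable.bound {S : Sequent L} (h : CutFreeProvable S) (hS : S.VarsBound) :
    CutFreeProvableBound S := by
  induction h with
  | node ps S hR _ ih => exact .node ps S ⟨hR, hS⟩ fun P hP => ih P hP (hR.varsBound hS P hP)

end RLL

theorem mainTheorem2 (L : RLL.Signature) (S : RLL.Sequent L) :
    (RLL.Provable S → RLL.CutFreeProvable S) ∧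
    (RLL.ProvableBound S → RLL.CutFreeProvableBound S) :=
  ⟨fun h => h.cutFreeProvable, fun h => h.provable.cutFreeProvable.bound h.varsBound⟩
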